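/- **Setting.** Let $d\ge 2$ and consider the density-ratio model $r(x;\theta)=\exp\{\alpha+\phi(x;\beta)\}$, $\theta=(\alpha,\beta)\in\Theta\subset\mathbb R\times\mathbb R^{d-1}$, with $\Theta$ open, $\phi$ measurable, and $\phi(x;\cdot)$ differentiable on the $\beta$-parts of $\Theta$ for every $x$. Let $\theta^*=(\alpha^*,\beta^*)\in\Theta$ satisfy $r(x;\theta^*)=1$ for all $x$; $\nabla$ is the gradient in $\theta$. Let $f$ be convex on $(0,\infty)$ and differentiable near $1$, with $f(1)=f'(1)=0$, and twice differentiable at $1$ with $f''(1)>0$. The sample sizes $m_{\rm n},m_{\rm d}$ tend to infinity with $m_{\rm n}/m_{\rm d}\to\rho\in(0,\infty)$; put $m=m_{\rm n}m_{\rm d}/(m_{\rm n}+m_{\rm d})$. **Local alternatives.** Let $p_{\rm d}=p$ be a fixed probability density, $\theta_m=\theta^*+h_m/\sqrt m$ with $h_m\to h\in\mathbb R^d$, and suppose that $p_{\rm n}^{(m)}=p\,r(\cdot;\theta_m)$ is a probability density. One observes independent samples $x^{(\rm n)}_1,\dots,x^{(\rm n)}_{m_{\rm n}}$ i.i.d.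 from $p_{\rm n}^{(m)}$ and $x^{(\rm d)}_1,\dots,x^{(\rm d)}_{m_{\rm d}}$ i.i.d. from $p_{\rm d}$; all convergences below are under these laws. **Statistics.** In the estimators, $\rho$ may stand either for $m_{\rm n}/m_{\rm d}$ or for its limit (or for any sequence with this limit). Let $\eta_{\rm opt}(x;\theta)=\frac{1}{1+\rho r(x;\theta)}\nabla\log r(x;\theta)$, and let $\widehat\theta=(\widehat\alpha,\widehat\beta)$ be a measurable function of the samples that, with probability tending to $1$, lies in $\Theta$ and solves $$\frac1{m_{\rm d}}\sum_i r(x^{(\rm d)}_i;\theta)\,\eta_{\rm opt}(x^{(\rm d)}_i;\theta)-\frac1{m_{\rm n}}\sum_j\eta_{\rm opt}(x^{(\rm n)}_j;\theta)=0 .$$ Put $$\widehat D_f=\frac1{m_{\rm d}}\sum_i\frac{f(r(x_i^{(\rm d)};\widehat\theta))}{1+\rho r(x_i^{(\rm d)};\widehat\theta)}+\frac1{m_{\rm n}}\sum_j\frac{\rho f(r(x_j^{(\rm n)};\widehat\theta))}{1+\rho r(x_j^{(\rm n)};\widehat\theta)},\qquad S=m(\widehat\beta-\beta^*)^T\widehat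 V(\widehat\beta-\beta^*),$$ where $\widehat V$ converges in probability to the covariance matrix of $\nabla_\beta\phi(x;\beta^*)$ under $p$. For $0<\alpha<1$ let $\chi^2_{d-1}(1-\alpha)$ be the $(1-\alpha)$-quantile of the chi-square distribution with $d-1$ degrees of freedom. The $\widehat D_f$-based test rejects $p_{\rm n}=p_{\rm d}$ if $\widehat D_f\ge\frac{f''(1)}{2m}\chi^2_{d-1}(1-\alpha)$; the empirical likelihood score test rejects if $S>\chi^2_{d-1}(1-\alpha)$. **Assumptions.** Let $M(\theta)=\int p\,\nabla\log r\,\nabla\log r^T\,dx$ and $U(\theta)=\int p\,\frac{1}{1+\rho r}\nabla\log r\,\nabla\log r^T\,dx$ (with $\rho$ the limit). 1. For $\theta$ near $\theta^*$, $\nabla\log r(\cdot;\theta)$ is square integrable under $p$, and $M$ and $U$ are continuous and non-degenerate. 2. $\frac1{m_{\rm n}}\sum_j\nabla r(x^{(\rm n)}_j;\theta^*)\nabla r(x^{(\rm n)}_j;\theta^*)^T\to M(\theta^*)$ in probability. 3. $\sqrt m\,U(\theta_m)(\widehat\theta-\theta_m)$ converges in law to $N\big(0,\frac1{(1+\rho)^2}V[\nabla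 r]\big)$, where $V[\nabla r]$ is the covariance matrix of $\nabla\log r(x;\theta^*)=\nabla r(x;\theta^*)$ under $p$. 4. (Regularity, automatic with $K=0$ when $\phi$ is linear in $\beta$.) There is a function $K$ with $\int K^2p\,dx<\infty$ and $\int K^2p_{\rm n}^{(m)}dx$ bounded for large $m$ such that $|\phi(x;\beta)-\phi(x;\beta^*)-\nabla_\beta\phi(x;\beta^*)^T(\beta-\beta^*)|\le K(x)\|\beta-\beta^*\|^2$ for all $x$ and all $\beta$ in a neighbourhood of $\beta^*$. **Theorem.** For every $\alpha\in(0,1)$, the probability that the $\widehat D_f$-based test rejects converges to $\Pr\{Y\ge\chi^2_{d-1}(1-\alpha)\}$, where $Y$ has the non-central chi-square distribution with $d-1$ degrees of freedom and non-centrality parameter $h^TM(\theta^*)h$. The rejection probability of the empirical likelihood score test converges to the same limit. In particular the asymptotic power does not depend on the choice of $f$. -/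

import Mathlib

open MeasureTheory ProbabilityTheory Filter Topology

noncomputable section

namespace DensityRatio

/-- Parameters `θ = (α, β)` with `β ∈ ℝ^k`, so that the dimension of the model is `d = k + 1`;
coordinate `0` is `α`, the coordinates `1, …, k` are `β`. -/
abbrev Param (k : ℕ) : Type := EuclideanSpace ℝ (Fin (k + 1))

/-- The `β` part of `θ = (α, β)`. -/
def betaPart {k : ℕ} (θ : Param k) : EuclideanSpace ℝ (Fin k) :=
  WithLp.toLp 2 (fun i => θ i.succ)

section Model

variable {X : Type*} {k : ℕ}

/-- The exponential density-ratio model `r(x; θ) = exp (α + φ(x; β))`. -/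
def ratio (φ : X → EuclideanSpace ℝ (Fin k) → ℝ) (x : X) (θ : Param k) : ℝ :=
  Real.exp (θ 0 + φ x (betaPart θ))

/-- `∇ r(x; θ)`, the gradient in `θ`. -/
def gradRatio (φ : X → EuclideanSpace ℝ (Fin k) → ℝ) (x : X) (θ : Param k) : Param k :=
  gradient (fun t => ratio φ x t) θ

/-- `∇ log r(x; θ)`, the gradient in `θ`. -/
def gradLogRatio (φ : X → EuclideanSpace ℝ (Fin k) → ℝ) (x : X) (θ : Param k) : Param k :=
  gradient (fun t => Real.log (ratio φ x t)) θ

/-- `η_opt(x; θ) = (1 + ρ r(x; θ))⁻¹ ∇ log r(x; θ)`. -/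
def etaOpt (φ : X → EuclideanSpace ℝ (Fin k) → ℝ) (ρ : ℝ) (x : X) (θ : Param k) : Param k :=
  (1 + ρ * ratio φ x θ)⁻¹ • gradLogRatio φ x θ

/-- The estimating function `Q_η(θ)` for `η = η_opt`, from the samples `xn` (numerator) and
`xd` (denominator). -/
def estimatingFn (φ : X → EuclideanSpace ℝ (Fin k) → ℝ) (ρ : ℝ) {mn md : ℕ}
    (xn : Fin mn → X) (xd : Fin md → X) (θ : Param k) : Param k :=
  (md : ℝ)⁻¹ • ∑ i, ratio φ (xd i) θ • etaOpt φ ρ (xd i) θ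
    - (mn : ℝ)⁻¹ • ∑ j, etaOpt φ ρ (xn j) θ

/-- The estimator of the `f`-divergence at the parameter value `θ`, for the decomposition
`f(r) = f_d(r) + r f_n(r)` with `f_d(r) = f(r) / (1 + ρ r)` and `f_n(r) = ρ f(r) / (1 + ρ r)`. -/
def divergenceEst (φ : X → EuclideanSpace ℝ (Fin k) → ℝ) (f : ℝ → ℝ) (ρ : ℝ) {mn md : ℕ}
    (xn : Fin mn → X) (xd : Fin md → X) (θ : Param k) : ℝ :=
  (md : ℝ)⁻¹ * ∑ i, f (ratio φ (xd i) θ) / (1 + ρ * ratio φ (xd i) θ)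
    + (mn : ℝ)⁻¹ * ∑ j, ρ * f (ratio φ (xn j) θ) / (1 + ρ * ratio φ (xn j) θ)

end Model

/-- The sample size `m = (1 / m_n + 1 / m_d)⁻¹ = m_n m_d / (m_n + m_d)`. -/
def effSize (mn md : ℕ) : ℝ := (mn : ℝ) * md / (mn + md)

/-- The empirical likelihood score statistic
`S = m (β̂ - β*)ᵀ V̂ (β̂ - β*)`. -/
def scoreStat {k : ℕ} (m : ℝ) (V : Matrix (Fin k) (Fin k) ℝ) (θhat θs : Param k) : ℝ :=
  m * ∑ i, ∑ j, (betaPart θhat - betaPart θs) i * V i j * (betaPart θhat - betaPart θs) j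

section Laws

variable {X : Type*} [MeasurableSpace X] {k : ℕ}

/-- The distribution with density `r(·; θ)` with respect to `P`. -/
def numLaw (P : Measure X) (φ : X → EuclideanSpace ℝ (Fin k) → ℝ) (θ : Param k) : Measure X :=
  P.withDensity (fun x => ENNReal.ofReal (ratio φ x θ))

/-- The joint law of two independent samples: `mn` i.i.d. points from `Pn` and `md` i.i.d. points
from `Pd`. -/
abbrev sampleLaw (Pn Pd : Measure X) (mn md : ℕ) : Measure ((Fin mn → X) × (Fin md → X)) :=
  (Measure.pi (fun _ => Pn)).prod (Measure.pi (fun _ => Pd))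

/-- `M(θ) = ∫ ∇ log r ∇ log rᵀ dP`. -/
def matM (P : Measure X) (φ : X → EuclideanSpace ℝ (Fin k) → ℝ) (θ : Param k) :
    Matrix (Fin (k + 1)) (Fin (k + 1)) ℝ :=
  Matrix.of fun i j => ∫ x, gradLogRatio φ x θ i * gradLogRatio φ x θ j ∂P

/-- `U(θ) = ∫ (1 + ρ r)⁻¹ ∇ log r ∇ log rᵀ dP`. -/
def matU (P : Measure X) (φ : X → EuclideanSpace ℝ (Fin k) → ℝ) (ρ : ℝ) (θ : Param k) :
    Matrix (Fin (k + 1)) (Fin (k + 1)) ℝ :=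
  Matrix.of fun i j =>
    ∫ x, (1 + ρ * ratio φ x θ)⁻¹ * (gradLogRatio φ x θ i * gradLogRatio φ x θ j) ∂P

/-- The variance-covariance matrix of a random vector `Y` under `P`. -/
def covMat {n : ℕ} (P : Measure X) (Y : X → EuclideanSpace ℝ (Fin n)) :
    Matrix (Fin n) (Fin n) ℝ :=
  Matrix.of fun i j => covariance (fun x => Y x i) (fun x => Y x j) P

end Laws

/-- The non-central chi-square distribution with `k ≥ 1` degrees of freedom and non-centrality
parameter `nc ≥ 0`: the law of `∑ i, Y_i ^ 2` for independent `Y_i ∼ N(μ_i, 1)` with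
`∑ i, μ_i ^ 2 = nc` (the law depends on the `μ_i` only through this sum; here
`μ = (√nc, 0, …, 0)`). -/
def noncentralChiSq (k : ℕ) (nc : ℝ) : Measure ℝ :=
  (Measure.pi (fun i : Fin k => gaussianReal (if i.val = 0 then Real.sqrt nc else 0) 1)).map
    (fun y => ∑ i, y i ^ 2)

/-- The chi-square distribution with `k` degrees of freedom. -/
def chiSq (k : ℕ) : Measure ℝ :=
  (Measure.pi (fun _ : Fin k => gaussianReal 0 1)).map (fun y => ∑ i, y i ^ 2)

/-- The quantile `χ²_k(q)` of the chi-square distribution, for `0 < q < 1`. -/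
def chiSqQuantile (k : ℕ) (q : ℝ) : ℝ := sInf {t : ℝ | q ≤ (chiSq k (Set.Iic t)).toReal}

end DensityRatio

end

/-! Write g = ∇ log r(·; θ*), M = M(θ*) with first row m₀, V for the covariance matrix of g, and Z =
√m (θ̂ − θ*). Both statistics are asymptotically quadratic forms in Z. Near the null, log r(x; θ̂) ≈
⟨g(x), θ̂ − θ*⟩ and f(eˢ) ≈ f''(1) s²/2; the weights 1/(1+ρ) and ρ/(1+ρ) of the two samples add up
to one, so (2m/f''(1)) D̂_f = ZᵀMZ + o_P(1) for every f. Likewise S = Z_βᵀ V_β Z_β + o_P(1).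

The model has an intercept, so g₀ = 1, V = M − m₀ᵀm₀, and ZᵀMZ = (m₀·Z)² + Z_βᵀ V_β Z_β
(`quadratic_eq_add`). By the central limit hypothesis and U(θ*) = M/(1+ρ), Z converges in law to h +
(1+ρ)M⁻¹ξ with ξ ∼ N(0, V/(1+ρ)²). Here ξ₀ = 0 almost surely because V₀₀ = 0, and m₀·h = 0 because
the alternatives have total mass one (`integral_inner_eq_zero`). Hence m₀·Z vanishes in the limit
and the two forms share one limit law. Whitening by a square root of V_β identifies it as
non-central chi-square, with non-centrality h_βᵀ V_β h_β = hᵀMh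
(`map_multivariateGaussian_quadratic`).

The delicate point is that the expansion must hold uniformly over the sample, that is max ‖g(x_i)‖²
= o_P(m), also under the moving law Q_N of the numerator. Under p this follows from integrability of
‖g‖². Under Q_N, the law of large numbers and independence give n Q_N(‖g‖² > Lm) → 0 for one
constant L (`exists_large_score`); off a set of Q_N-probability o(1/n) the density of Q_N is then
bounded, so its tails are controlled by those of p (`tendsto_score`).

Convergence in probability is convergence along the filter `whp`. Tightness of the normalized error
permits working where it is bounded, and `tendsto_measure_tail` turns an o_P(1) approximation into
convergence of rejection probabilities, as the limit law has no atoms. -/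

noncomputable section

namespace DensityRatio

/-! ### Convergence in probability as convergence along a filter. -/

section Whp

variable {Ω : ℕ → Type*} [∀ N, MeasurableSpace (Ω N)]

/-- The filter of events whose probability tends to one; convergence along it is
convergence in probability. -/
def whp (μ : ∀ N, Measure (Ω N)) : Filter (Σ N, Ω N) where
  sets := {A | Tendsto (fun N => μ N {ω | ⟨N, ω⟩ ∉ A}) atTop (𝓝 0)}
  univ_sets := by simp
  sets_of_superset {A B} hA hAB := by
    refine tendsto_of_tendsto_of_tendsto_of_le_of_le tendsto_const_nhds hA (fun _ => zero_le) ?_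
    exact fun N => measure_mono fun ω hω h => hω (hAB h)
  inter_sets {A B} hA hB := by
    have h : Tendsto (fun N => μ N {ω | ⟨N, ω⟩ ∉ A} + μ N {ω | ⟨N, ω⟩ ∉ B}) atTop (𝓝 0) := by
      simpa using Tendsto.add hA hB
    refine tendsto_of_tendsto_of_tendsto_of_le_of_le tendsto_const_nhds h (fun _ => zero_le) ?_
    intro N
    refine (measure_mono ?_).trans (measure_union_le _ _)
    intro ω hω
    simp only [Set.mem_ofPred_eq, Set.mem_inter_iff, not_and_or] at hω
    exact hω

variable {μ : ∀ N, Measure (Ω N)}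

lemma eventually_whp {p : (Σ N, Ω N) → Prop} :
    (∀ᶠ a in whp μ, p a) ↔ Tendsto (fun N => μ N {ω | ¬ p ⟨N, ω⟩}) atTop (𝓝 0) := Iff.rfl

lemma eventually_whp_of_le {p : (Σ N, Ω N) → Prop} {b : ℕ → ENNReal}
    (hb : Tendsto b atTop (𝓝 0)) (h : ∀ᶠ N in atTop, μ N {ω | ¬ p ⟨N, ω⟩} ≤ b N) :
    ∀ᶠ a in whp μ, p a :=
  eventually_whp.2 (tendsto_of_tendsto_of_tendsto_of_le_of_le' tendsto_const_nhds hb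
    (Eventually.of_forall fun _ => zero_le) h)

/-- Every cofinite set of indices has probability tending to one, so deterministic limits in `N`
transfer to limits in probability by composition. -/
lemma tendsto_fst_whp : Tendsto Sigma.fst (whp μ) atTop := by
  refine tendsto_atTop.2 fun n => eventually_whp_of_le tendsto_const_nhds ?_
  filter_upwards [eventually_ge_atTop n] with N hN
  simp [hN]

lemma tendsto_whp_zero_iff {Y : (Σ N, Ω N) → ℝ} :
    Tendsto Y (whp μ) (𝓝 0) ↔
      ∀ ε > 0, Tendsto (fun N => μ N {ω | ε < |Y ⟨N, ω⟩|}) atTop (𝓝 0) := by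
  rw [Metric.tendsto_nhds]
  constructor
  · intro h ε hε
    refine tendsto_of_tendsto_of_tendsto_of_le_of_le tendsto_const_nhds
      (eventually_whp.1 (h ε hε)) (fun _ => zero_le) fun N => measure_mono fun ω hω => ?_
    simp only [Set.mem_ofPred_eq, dist_zero_right, Real.norm_eq_abs, not_lt] at hω ⊢
    exact hω.le
  · intro h ε hε
    refine eventually_whp_of_le (h (ε / 2) (by positivity)) (Eventually.of_forall fun N =>
      measure_mono fun ω hω => ?_)
    simp only [Set.mem_ofPred_eq, dist_zero_right, Real.norm_eq_abs, not_lt] at hω ⊢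
    linarith

lemma tendsto_whp_iff {Y : (Σ N, Ω N) → ℝ} {c : ℝ} :
    Tendsto Y (whp μ) (𝓝 c) ↔
      ∀ ε > 0, Tendsto (fun N => μ N {ω | ε < |Y ⟨N, ω⟩ - c|}) atTop (𝓝 0) := by
  rw [← tendsto_sub_nhds_zero_iff, tendsto_whp_zero_iff]

/-- Tightness allows one to argue on the events where a sequence is bounded. -/
lemma eventually_whp_of_tight {E : Type*} [Norm E] {G : ∀ N, Ω N → E}
    (hG : ∀ η > (0 : ENNReal), ∃ R : ℝ, ∀ᶠ N in atTop, μ N {ω | R < ‖G N ω‖} ≤ η)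
    {p : (Σ N, Ω N) → Prop}
    (h : ∀ R : ℝ, ∀ᶠ a in whp μ ⊓ 𝓟 {a | ‖G a.1 a.2‖ ≤ R}, p a) :
    ∀ᶠ a in whp μ, p a := by
  rw [eventually_whp, ENNReal.tendsto_nhds_zero]
  intro η hη
  obtain ⟨R, hR⟩ := hG (η / 2) (ENNReal.half_pos hη.ne')
  have h1 := eventually_whp.1 (eventually_inf_principal.1 (h R))
  filter_upwards [hR, ENNReal.tendsto_nhds_zero.1 h1 (η / 2) (ENNReal.half_pos hη.ne')] with N h2 h3
  calc _ ≤ _ := measure_mono (t := {ω | R < ‖G N ω‖} ∪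
            {ω | ¬ (⟨N, ω⟩ ∈ {a : Σ N, Ω N | ‖G a.1 a.2‖ ≤ R} → p ⟨N, ω⟩)}) ?_
    _ ≤ _ := measure_union_le _ _
    _ ≤ η / 2 + η / 2 := add_le_add h2 h3
    _ = η := ENNReal.add_halves η
  intro ω hω
  by_cases hc : ‖G N ω‖ ≤ R
  · exact Or.inr fun h => hω (h hc)
  · exact Or.inl (not_le.1 hc)

lemma tendsto_whp_of_tight {E : Type*} [Norm E] {G : ∀ N, Ω N → E}
    (hG : ∀ η > (0 : ENNReal), ∃ R : ℝ, ∀ᶠ N in atTop, μ N {ω | R < ‖G N ω‖} ≤ η)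
    {Y : (Σ N, Ω N) → ℝ} {c : ℝ}
    (h : ∀ R : ℝ, Tendsto Y (whp μ ⊓ 𝓟 {a | ‖G a.1 a.2‖ ≤ R}) (𝓝 c)) :
    Tendsto Y (whp μ) (𝓝 c) :=
  fun _ hs => eventually_whp_of_tight hG fun R => h R hs

end Whp

/-! ### Weak convergence, tightness and tail probabilities. -/

section Portmanteau

variable {Ω : ℕ → Type*} [∀ N, MeasurableSpace (Ω N)] {μ : ∀ N, Measure (Ω N)}
  [∀ N, IsProbabilityMeasure (μ N)] {E : Type*} [MeasurableSpace E]
  {ν : Measure E} [IsProbabilityMeasure ν] {G : ∀ N, Ω N → E}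

lemma limsup_measure_closed_le_of_tendstoInDistribution [TopologicalSpace E]
    [OpensMeasurableSpace E] [HasOuterApproxClosed E]
    (hG : TendstoInDistribution G atTop (fun z => z) μ ν) {F : Set E} (hF : IsClosed F) :
    limsup (fun N => μ N {ω | G N ω ∈ F}) atTop ≤ ν F := by
  have h := ProbabilityMeasure.limsup_measure_closed_le_of_tendsto hG.tendsto hF
  simp only [ProbabilityMeasure.coe_mk, Measure.map_id'] at h
  simp only [Measure.map_apply_of_aemeasurable (hG.forall_aemeasurable _) hF.measurableSet] at h
  exact h

lemma le_liminf_measure_open_of_tendstoInDistribution [TopologicalSpace E]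
    [OpensMeasurableSpace E] [HasOuterApproxClosed E]
    (hG : TendstoInDistribution G atTop (fun z => z) μ ν) {F : Set E} (hF : IsOpen F) :
    ν F ≤ liminf (fun N => μ N {ω | G N ω ∈ F}) atTop := by
  have h := ProbabilityMeasure.le_liminf_measure_open_of_tendsto hG.tendsto hF
  simp only [ProbabilityMeasure.coe_mk, Measure.map_id'] at h
  simp only [Measure.map_apply_of_aemeasurable (hG.forall_aemeasurable _) hF.measurableSet] at h
  exact h

/-- The closed sets `n ≤ ‖z‖` decrease to the empty set, so one of them has small limit mass, and
the closed-set half of the portmanteau theorem passes this to the laws of `G N`. -/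
lemma tight_of_tendstoInDistribution [NormedAddCommGroup E] [BorelSpace E]
    (hG : TendstoInDistribution G atTop (fun z => z) μ ν) (η : ENNReal) (hη : 0 < η) :
    ∃ R : ℝ, ∀ᶠ N in atTop, μ N {ω | R < ‖G N ω‖} ≤ η := by
  have hanti : Antitone fun n : ℕ => {z : E | (n : ℝ) ≤ ‖z‖} := fun a b hab z hz =>
    le_trans (by exact_mod_cast hab) (show (b : ℝ) ≤ ‖z‖ from hz)
  have hcl : ∀ n : ℕ, IsClosed {z : E | (n : ℝ) ≤ ‖z‖} := fun n =>
    isClosed_le continuous_const continuous_norm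
  have h := tendsto_measure_iInter_atTop (μ := ν)
    (fun n => (hcl n).measurableSet.nullMeasurableSet) hanti ⟨0, measure_ne_top _ _⟩
  have h0 : ⋂ n : ℕ, {z : E | (n : ℝ) ≤ ‖z‖} = ∅ := by
    refine Set.eq_empty_of_forall_notMem fun z hz => ?_
    obtain ⟨n, hn⟩ := exists_nat_gt ‖z‖
    exact absurd (Set.mem_iInter.1 hz n) (not_le.2 hn)
  rw [h0, measure_empty] at h
  obtain ⟨n, hn⟩ := (h.eventually (gt_mem_nhds hη)).exists
  refine ⟨n, ?_⟩
  have := eventually_lt_of_limsup_lt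
    ((limsup_measure_closed_le_of_tendstoInDistribution hG (hcl n)).trans_lt hn)
  filter_upwards [this] with N hN
  exact (measure_mono fun ω (hω : (n : ℝ) < ‖G N ω‖) => hω.le).trans hN.le

/-- If `G N` converges in law and `T - q (G N)` converges to zero in probability, the upper tail
probabilities of `T` converge at every `c` which is not an atom of the limit law of `q (G N)`. -/
lemma tendsto_measure_tail [TopologicalSpace E] [OpensMeasurableSpace E] [HasOuterApproxClosed E]
    (hG : TendstoInDistribution G atTop (fun z => z) μ ν) {q : E → ℝ} (hq : Continuous q)
    {T : (Σ N, Ω N) → ℝ} (hT : Tendsto (fun a => T a - q (G a.1 a.2)) (whp μ) (𝓝 0))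
    {c : ℝ} (hc : ν {z | q z = c} = 0) {A : ∀ N, Set (Ω N)}
    (hA1 : ∀ᶠ N in atTop, {ω | c < T ⟨N, ω⟩} ⊆ A N)
    (hA2 : ∀ᶠ N in atTop, A N ⊆ {ω | c ≤ T ⟨N, ω⟩}) :
    Tendsto (fun N => μ N (A N)) atTop (𝓝 (ν {z | c ≤ q z})) := by
  rw [tendsto_whp_zero_iff] at hT
  rw [tendsto_order]
  constructor
  · intro b hb
    -- Without an atom at `c` the open tail carries the whole mass; it is then exhausted by the open
    -- sets `c + ε < q z`, whose margin `ε` absorbs the error of `T`.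
    have hle : ν {z | c ≤ q z} ≤ ν {z | c < q z} := by
      calc _ ≤ ν ({z | c < q z} ∪ {z | q z = c}) := measure_mono fun z hz => by
            rcases lt_or_eq_of_le (show c ≤ q z from hz) with h | h
            · exact Or.inl h
            · exact Or.inr h.symm
        _ ≤ _ := measure_union_le _ _
        _ = _ := by rw [hc, add_zero]
    obtain ⟨b', hb1, hb2⟩ := exists_between (hb.trans_le hle)
    have hmono : Monotone fun n : ℕ => {z : E | c + 1 / ((n : ℝ) + 1) < q z} := by
      intro i j hij z hz
      refine lt_of_le_of_lt ?_ (show c + 1 / ((i : ℝ) + 1) < q z from hz)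
      gcongr
    have hU : ⋃ n : ℕ, {z : E | c + 1 / ((n : ℝ) + 1) < q z} = {z | c < q z} := by
      ext z
      simp only [Set.mem_iUnion, Set.mem_ofPred_eq]
      constructor
      · rintro ⟨n, hn⟩
        have : (0 : ℝ) < 1 / ((n : ℝ) + 1) := by positivity
        linarith
      · intro hz
        obtain ⟨n, hn⟩ := exists_nat_one_div_lt (sub_pos.2 hz)
        exact ⟨n, by linarith⟩
    have hlim := tendsto_measure_iUnion_atTop (μ := ν) hmono
    rw [hU] at hlim
    obtain ⟨n, hn⟩ := (hlim.eventually (lt_mem_nhds hb2)).exists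
    have hε : (0 : ℝ) < 1 / ((n : ℝ) + 1) := by positivity
    set ε : ℝ := 1 / ((n : ℝ) + 1)
    have hopen : IsOpen {z : E | c + ε < q z} := isOpen_lt continuous_const hq
    have h1 := eventually_lt_of_lt_liminf
      (hn.trans_le (le_liminf_measure_open_of_tendstoInDistribution hG hopen))
    have h2 := (hT ε hε).eventually (gt_mem_nhds (tsub_pos_of_lt hb1))
    filter_upwards [h1, h2, hA1] with N h1 h2 h3
    by_contra hcon
    rw [not_lt] at hcon
    refine absurd h1 (not_lt.2 ?_)
    calc _ ≤ μ N (A N ∪ {ω | ε < |T ⟨N, ω⟩ - q (G N ω)|}) := measure_mono fun ω hω => by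
          by_cases hlt : c < T ⟨N, ω⟩
          · exact Or.inl (h3 hlt)
          · right
            have : c + ε < q (G N ω) := hω
            simp only [Set.mem_ofPred_eq, abs_sub_comm]
            exact lt_of_lt_of_le (by linarith) (le_abs_self _)
      _ ≤ _ := measure_union_le _ _
      _ ≤ b + (b' - b) := add_le_add hcon h2.le
      _ = b' := add_tsub_cancel_of_le hb1.le
  · intro b hb
    obtain ⟨b', hb1, hb2⟩ := exists_between hb
    -- For the upper bound the closed tail is approximated from outside by the closed sets `c - ε ≤
    -- q z`; no condition on atoms is needed here.
    have hanti : Antitone fun n : ℕ => {z : E | c - 1 / ((n : ℝ) + 1) ≤ q z} := by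
      intro i j hij z hz
      refine le_trans ?_ (show c - 1 / ((j : ℝ) + 1) ≤ q z from hz)
      gcongr
    have hcl : ∀ n : ℕ, IsClosed {z : E | c - 1 / ((n : ℝ) + 1) ≤ q z} := fun n =>
      isClosed_le continuous_const hq
    have hI : ⋂ n : ℕ, {z : E | c - 1 / ((n : ℝ) + 1) ≤ q z} = {z | c ≤ q z} := by
      ext z
      simp only [Set.mem_iInter, Set.mem_ofPred_eq]
      constructor
      · intro hz
        by_contra hlt
        obtain ⟨n, hn⟩ := exists_nat_one_div_lt (sub_pos.2 (not_le.1 hlt))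
        linarith [hz n]
      · intro hz n
        have : (0 : ℝ) < 1 / ((n : ℝ) + 1) := by positivity
        linarith
    have hlim := tendsto_measure_iInter_atTop (μ := ν)
      (fun n => (hcl n).measurableSet.nullMeasurableSet) hanti ⟨0, measure_ne_top _ _⟩
    rw [hI] at hlim
    obtain ⟨n, hn⟩ := (hlim.eventually (gt_mem_nhds hb1)).exists
    have hε : (0 : ℝ) < 1 / ((n : ℝ) + 1) := by positivity
    have hcln := hcl n
    set ε : ℝ := 1 / ((n : ℝ) + 1)
    have h1 := eventually_lt_of_limsup_lt
      ((limsup_measure_closed_le_of_tendstoInDistribution hG hcln).trans_lt hn)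
    have h2 := (hT ε hε).eventually (gt_mem_nhds (tsub_pos_of_lt hb2))
    filter_upwards [h1, h2, hA2] with N h1 h2 h3
    calc _ ≤ μ N ({ω | G N ω ∈ {z : E | c - ε ≤ q z}} ∪ {ω | ε < |T ⟨N, ω⟩ - q (G N ω)|}) :=
          measure_mono fun ω hω => by
          have h4 : c ≤ T ⟨N, ω⟩ := h3 hω
          by_cases hlt : c - ε ≤ q (G N ω)
          · exact Or.inl hlt
          · right
            simp only [Set.mem_ofPred_eq]
            exact lt_of_lt_of_le (by linarith) (le_abs_self _)
      _ ≤ _ := measure_union_le _ _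
      _ < b' + (b - b') := ENNReal.add_lt_add h1 h2
      _ = b := add_tsub_cancel_of_le hb2.le

end Portmanteau

/-! ### Averages of functions with a quadratic expansion. -/

section Averages

variable {α : Type*} {l : Filter α} {n : α → ℕ} {m : α → ℝ}

/-- Averages of functions with a common quadratic expansion at `0`, over points that are
uniformly close to `0`. -/
lemma tendsto_average_of_quadratic {H : α → ℝ → ℝ} {c : ℝ}
    (hH : ∀ ε > 0, ∃ δ > 0, ∀ᶠ a in l, ∀ s, |s| ≤ δ → |H a s - c * s ^ 2| ≤ ε * s ^ 2)
    {s : ∀ a, Fin (n a) → ℝ} (hs : ∀ ε > 0, ∀ᶠ a in l, ∀ i, |s a i| ≤ ε)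
    (hm : ∀ a, 0 ≤ m a) {W : α → ℝ} {B : ℝ} (hWB : ∀ᶠ a in l, |W a| ≤ B)
    (hW : Tendsto (fun a => m a * ((n a : ℝ)⁻¹ * ∑ i, s a i ^ 2) - W a) l (𝓝 0)) :
    Tendsto (fun a => m a * ((n a : ℝ)⁻¹ * ∑ i, H a (s a i)) - c * W a) l (𝓝 0) := by
  have h1 : Tendsto (fun a => m a * ((n a : ℝ)⁻¹ * ∑ i, (H a (s a i) - c * s a i ^ 2))) l (𝓝 0) := by
    rw [Metric.tendsto_nhds]
    intro ε hε
    have hB : 0 < |B| + 1 := by positivity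
    -- The scaled mean square is eventually at most `|B| + 1`, so this relative tolerance costs at
    -- most `ε / 2`.
    obtain ⟨δ, hδ, hHδ⟩ := hH (ε / (2 * (|B| + 1))) (by positivity)
    filter_upwards [hHδ, hs δ hδ, hWB, (Metric.tendsto_nhds.1 hW) 1 one_pos] with a h1 h2 h3 h4
    rw [Real.dist_eq, sub_zero] at h4 ⊢
    have hq : 0 ≤ m a * ((n a : ℝ)⁻¹ * ∑ i, s a i ^ 2) := by
      have := hm a
      positivity
    have hle : m a * ((n a : ℝ)⁻¹ * ∑ i, s a i ^ 2) ≤ |B| + 1 := by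
      have := le_abs_self (m a * ((n a : ℝ)⁻¹ * ∑ i, s a i ^ 2) - W a)
      have := le_abs_self (W a)
      have := le_abs_self B
      linarith
    calc _ = m a * ((n a : ℝ)⁻¹ * |∑ i, (H a (s a i) - c * s a i ^ 2)|) := by
          rw [abs_mul, abs_mul, abs_of_nonneg (hm a), abs_of_nonneg (by positivity)]
      _ ≤ m a * ((n a : ℝ)⁻¹ * ∑ i, (ε / (2 * (|B| + 1))) * s a i ^ 2) := by
          have := hm a
          gcongr
          exact (Finset.abs_sum_le_sum_abs _ _).trans
            (Finset.sum_le_sum fun i _ => h1 _ (h2 i))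
      _ = ε / (2 * (|B| + 1)) * (m a * ((n a : ℝ)⁻¹ * ∑ i, s a i ^ 2)) := by
          rw [← Finset.mul_sum]; ring
      _ ≤ ε / (2 * (|B| + 1)) * (|B| + 1) := by gcongr
      _ = ε / 2 := by field_simp
      _ < ε := by linarith
  have h2 := h1.add (hW.const_mul c)
  simp only [mul_zero, add_zero] at h2
  refine h2.congr fun a => ?_
  rw [Finset.sum_sub_distrib, ← Finset.mul_sum]
  ring

/-- Mean squares are stable under perturbations whose mean squares vanish. -/
lemma tendsto_mean_sq_of_approx (hm : ∀ a, 0 ≤ m a) {s t e : ∀ a, Fin (n a) → ℝ}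
    (hst : ∀ᶠ a in l, ∀ i, |s a i - t a i| ≤ e a i)
    (he : Tendsto (fun a => m a * ((n a : ℝ)⁻¹ * ∑ i, e a i ^ 2)) l (𝓝 0))
    {W : α → ℝ} {B : ℝ} (hWB : ∀ᶠ a in l, |W a| ≤ B)
    (hW : Tendsto (fun a => m a * ((n a : ℝ)⁻¹ * ∑ i, t a i ^ 2) - W a) l (𝓝 0)) :
    Tendsto (fun a => m a * ((n a : ℝ)⁻¹ * ∑ i, s a i ^ 2) - W a) l (𝓝 0) := by
  have hlim : Tendsto (fun a => 2 * √((|B| + 1) * (m a * ((n a : ℝ)⁻¹ * ∑ i, e a i ^ 2)))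
      + m a * ((n a : ℝ)⁻¹ * ∑ i, e a i ^ 2)) l (𝓝 0) := by
    have := ((he.const_mul (|B| + 1)).sqrt.const_mul 2).add he
    simpa using this
  have hd : Tendsto (fun a => m a * ((n a : ℝ)⁻¹ * ∑ i, s a i ^ 2)
      - m a * ((n a : ℝ)⁻¹ * ∑ i, t a i ^ 2)) l (𝓝 0) := by
    refine squeeze_zero_norm' ?_ hlim
    filter_upwards [hst, hWB, (Metric.tendsto_nhds.1 hW) 1 one_pos] with a h1 h3 h4
    rw [Real.dist_eq, sub_zero] at h4
    have hma := hm a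
    set E := ∑ i, e a i ^ 2
    set T := ∑ i, t a i ^ 2
    set p := m a * (n a : ℝ)⁻¹ with hp
    have hp0 : 0 ≤ p := by positivity
    have hT0 : 0 ≤ T := by positivity
    have hE0 : 0 ≤ E := by positivity
    have hle : p * T ≤ |B| + 1 := by
      have := le_abs_self (m a * ((n a : ℝ)⁻¹ * T) - W a)
      have := le_abs_self (W a)
      have := le_abs_self B
      rw [hp, mul_assoc]
      linarith
    have he0 : ∀ i, 0 ≤ e a i := fun i => (abs_nonneg _).trans (h1 i)
    -- Cauchy–Schwarz for the cross term of `s² − t² = 2t(s − t) + (s − t)²`.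
    have hcs : ∑ i, |t a i| * e a i ≤ √(T * E) := by
      refine Real.le_sqrt_of_sq_le ?_
      have := Finset.sum_mul_sq_le_sq_mul_sq Finset.univ (fun i => |t a i|) (e a)
      simpa only [sq_abs] using this
    have hsum : |∑ i, s a i ^ 2 - T| ≤ 2 * √(T * E) + E := by
      rw [← Finset.sum_sub_distrib]
      calc _ ≤ ∑ i, |s a i ^ 2 - t a i ^ 2| := Finset.abs_sum_le_sum_abs _ _
        _ ≤ ∑ i, (2 * (|t a i| * e a i) + e a i ^ 2) := by
            refine Finset.sum_le_sum fun i _ => ?_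
            have h5 : s a i ^ 2 - t a i ^ 2
              = 2 * (t a i * (s a i - t a i)) + (s a i - t a i) ^ 2 := by ring
            rw [h5]
            refine (abs_add_le _ _).trans ?_
            rw [abs_mul, abs_mul, abs_pow, abs_two]
            have := h1 i
            gcongr
        _ = 2 * ∑ i, |t a i| * e a i + E := by
            rw [Finset.sum_add_distrib, ← Finset.mul_sum]
        _ ≤ _ := by gcongr
    have hsq : p * √(T * E) = √((p * T) * (p * E)) := by
      rw [show p * T * (p * E) = p ^ 2 * (T * E) by ring, Real.sqrt_mul (sq_nonneg p),
        Real.sqrt_sq hp0]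
    calc ‖_‖ = p * |∑ i, s a i ^ 2 - T| := by
          rw [Real.norm_eq_abs, ← mul_assoc, ← mul_assoc, ← mul_sub, abs_mul, abs_of_nonneg hp0]
      _ ≤ p * (2 * √(T * E) + E) := by gcongr
      _ = 2 * √((p * T) * (p * E)) + p * E := by rw [← hsq]; ring
      _ ≤ 2 * √((|B| + 1) * (p * E)) + p * E := by gcongr
      _ = _ := by rw [hp]; ring_nf
  simpa using hd.add hW

end Averages

/-! ### Empirical second moments and quadratic forms in the local parameter. -/

section QuadraticForm

variable {d : ℕ}

/-- The average of `⟪g i, δ⟫ ^ 2` is the quadratic form of the empirical second moments. -/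
lemma average_sq_eq_quadratic {n : ℕ} (g : Fin n → EuclideanSpace ℝ (Fin d))
    (z : EuclideanSpace ℝ (Fin d)) :
    (n : ℝ)⁻¹ * ∑ i, inner ℝ (g i) z ^ 2
      = ∑ j, ∑ k, z j * ((n : ℝ)⁻¹ * ∑ i, g i j * g i k) * z k := by
  have h : ∀ i, inner ℝ (g i) z ^ 2 = ∑ j, ∑ k, z j * (g i j * g i k) * z k := fun i => by
    rw [PiLp.inner_apply, sq, Finset.sum_mul_sum]
    refine Finset.sum_congr rfl fun j _ => Finset.sum_congr rfl fun k _ => ?_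
    simp only [RCLike.inner_apply, conj_trivial]
    ring
  simp_rw [h]
  rw [Finset.sum_comm, Finset.mul_sum]
  refine Finset.sum_congr rfl fun j _ => ?_
  rw [Finset.sum_comm, Finset.mul_sum]
  refine Finset.sum_congr rfl fun k _ => ?_
  rw [← Finset.sum_mul, ← Finset.mul_sum]
  ring

variable {α : Type*} {l : Filter α}

/-- Only boundedness of `z` is used, not convergence: the random matrix is replaced by its limit
while the argument keeps fluctuating. -/
lemma tendsto_quadratic_sub {Mhat : α → Matrix (Fin d) (Fin d) ℝ} {M : Matrix (Fin d) (Fin d) ℝ}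
    (hM : ∀ i j, Tendsto (fun a => Mhat a i j) l (𝓝 (M i j)))
    {z : α → EuclideanSpace ℝ (Fin d)} {R : ℝ} (hz : ∀ᶠ a in l, ‖z a‖ ≤ R) :
    Tendsto (fun a => ∑ i, ∑ j, z a i * Mhat a i j * z a j
      - ∑ i, ∑ j, z a i * M i j * z a j) l (𝓝 0) := by
  have h : ∀ i j, Tendsto (fun a => z a i * z a j * (Mhat a i j - M i j)) l (𝓝 0) := fun i j => by
    refine bdd_le_mul_tendsto_zero' (R * R) ?_ (tendsto_sub_nhds_zero_iff.2 (hM i j))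
    filter_upwards [hz] with a ha
    have hb : ∀ i, |z a i| ≤ R := fun i => (PiLp.norm_apply_le (z a) i).trans ha
    rw [abs_mul]
    exact mul_le_mul (hb i) (hb j) (abs_nonneg _) ((abs_nonneg _).trans (hb i))
  have h2 : Tendsto (fun a => ∑ i, ∑ j, z a i * z a j * (Mhat a i j - M i j)) l (𝓝 0) := by
    simpa using tendsto_finsetSum Finset.univ fun i _ => tendsto_finsetSum Finset.univ
      fun j _ => h i j
  refine h2.congr fun a => ?_
  rw [← Finset.sum_sub_distrib]
  refine Finset.sum_congr rfl fun i _ => ?_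
  rw [← Finset.sum_sub_distrib]
  exact Finset.sum_congr rfl fun j _ => by ring

/-- Averages of functions with a quadratic expansion, over the increments of a smooth function at
the local scale `(√m)⁻¹`, are asymptotically a quadratic form in the local parameter. -/
lemma tendsto_average_local {n : α → ℕ} {m : α → ℝ} (hm : ∀ a, 0 ≤ m a)
    (hmtop : Tendsto m l atTop) {H : α → ℝ → ℝ} {c : ℝ}
    (hH : ∀ ε > 0, ∃ δ > 0, ∀ᶠ a in l, ∀ s, |s| ≤ δ → |H a s - c * s ^ 2| ≤ ε * s ^ 2)
    {z : α → EuclideanSpace ℝ (Fin d)} {R : ℝ} (hz : ∀ᶠ a in l, ‖z a‖ ≤ R)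
    {g : ∀ a, Fin (n a) → EuclideanSpace ℝ (Fin d)}
    (hg : ∀ ε > 0, ∀ᶠ a in l, ∀ i, ‖g a i‖ ^ 2 ≤ ε * m a)
    {M : Matrix (Fin d) (Fin d) ℝ}
    (hM : ∀ j k, Tendsto (fun a => (n a : ℝ)⁻¹ * ∑ i, g a i j * g a i k) l (𝓝 (M j k)))
    {κ : ∀ a, Fin (n a) → ℝ} (hκ : ∀ ε > 0, ∀ᶠ a in l, ∀ i, κ a i ≤ ε * m a)
    (hκ2 : Tendsto (fun a => (m a)⁻¹ * ((n a : ℝ)⁻¹ * ∑ i, κ a i ^ 2)) l (𝓝 0))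
    {s : ∀ a, Fin (n a) → ℝ} {δ : α → EuclideanSpace ℝ (Fin d)}
    (hδ : ∀ a, 0 < m a → δ a = (√(m a))⁻¹ • z a)
    (hs : ∀ᶠ a in l, ∀ i, |s a i - inner ℝ (g a i) (δ a)| ≤ κ a i * ‖δ a‖ ^ 2) :
    Tendsto (fun a => m a * ((n a : ℝ)⁻¹ * ∑ i, H a (s a i))
      - c * ∑ i, ∑ j, z a i * M i j * z a j) l (𝓝 0) := by
  have hpos : ∀ᶠ a in l, 0 < m a := hmtop.eventually_gt_atTop 0
  have hbound : ∀ᶠ a in l, |∑ i, ∑ j, z a i * M i j * z a j| ≤ ∑ i, ∑ j, |R| * |M i j| * |R| := by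
    filter_upwards [hz] with a ha
    have hb : ∀ i, |z a i| ≤ |R| := fun i =>
      ((PiLp.norm_apply_le (z a) i).trans ha).trans (le_abs_self R)
    refine (Finset.abs_sum_le_sum_abs _ _).trans (Finset.sum_le_sum fun i _ =>
      (Finset.abs_sum_le_sum_abs _ _).trans (Finset.sum_le_sum fun j _ => ?_))
    rw [abs_mul, abs_mul]
    have := hb i
    have := hb j
    gcongr
  refine tendsto_average_of_quadratic hH (fun ε hε => ?_) hm hbound ?_
  -- The linear part of an increment is at most `η |R|` and its remainder at most `η² |R|²`; the
  -- bound `η ≤ 1` reduces the latter to `η |R|²`, so both together stay below `ε`.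
  · set η := min 1 (ε / (|R| + |R| ^ 2 + 1)) with hη
    have hη0 : 0 < η := by positivity
    have hη1 : η ≤ 1 := min_le_left _ _
    have hη2 : η * (|R| + |R| ^ 2) ≤ ε := by
      calc _ ≤ ε / (|R| + |R| ^ 2 + 1) * (|R| + |R| ^ 2 + 1) :=
            mul_le_mul (min_le_right _ _) (by linarith) (by positivity) (by positivity)
        _ = ε := by field_simp
    filter_upwards [hpos, hz, hg (η ^ 2) (by positivity), hκ (η ^ 2) (by positivity), hs]
      with a h1 h2 h3 h4 h5 i
    have hsm : 0 < √(m a) := Real.sqrt_pos.2 h1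
    have hδn : ‖δ a‖ ≤ (√(m a))⁻¹ * |R| := by
      rw [hδ a h1, norm_smul, norm_inv, Real.norm_of_nonneg hsm.le]
      gcongr
      exact h2.trans (le_abs_self R)
    have hgn : ‖g a i‖ ≤ η * √(m a) := by
      rw [← Real.sqrt_sq hη0.le, ← Real.sqrt_mul (sq_nonneg η)]
      exact Real.le_sqrt_of_sq_le (h3 i)
    have e1 : |inner ℝ (g a i) (δ a)| ≤ η * |R| := by
      calc _ ≤ ‖g a i‖ * ‖δ a‖ := abs_real_inner_le_norm _ _
        _ ≤ (η * √(m a)) * ((√(m a))⁻¹ * |R|) := by gcongr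
        _ = η * |R| := by field_simp
    have e2 : κ a i * ‖δ a‖ ^ 2 ≤ η * |R| ^ 2 := by
      calc _ ≤ (η ^ 2 * m a) * ‖δ a‖ ^ 2 := by gcongr; exact h4 i
        _ ≤ (η ^ 2 * m a) * ((√(m a))⁻¹ * |R|) ^ 2 := by gcongr
        _ = η ^ 2 * |R| ^ 2 := by
            rw [mul_pow, inv_pow, Real.sq_sqrt h1.le]; field_simp
        _ ≤ η * |R| ^ 2 := by
            gcongr
            exact pow_le_of_le_one hη0.le hη1 two_ne_zero
    have e3 := h5 i
    have := abs_sub_abs_le_abs_sub (s a i) (inner ℝ (g a i) (δ a))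
    nlinarith
  · refine tendsto_mean_sq_of_approx hm hs ?_ hbound ?_
    -- Since `‖δ‖² = ‖z‖² / m`, the scaled mean square of the remainders is `‖z‖⁴` times `m⁻¹` times
    -- the mean of `κ²`.
    · have hz4 : ∀ᶠ a in l, |‖z a‖ ^ 4| ≤ |R| ^ 4 := by
        filter_upwards [hz] with a ha
        rw [abs_of_nonneg (by positivity)]
        gcongr
        exact ha.trans (le_abs_self R)
      refine (bdd_le_mul_tendsto_zero' _ hz4 hκ2).congr' ?_
      filter_upwards [hpos] with a h1
      have hn : ‖δ a‖ ^ 2 = (m a)⁻¹ * ‖z a‖ ^ 2 := by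
        rw [hδ a h1, norm_smul, norm_inv, Real.norm_of_nonneg (Real.sqrt_nonneg _), mul_pow,
          inv_pow, Real.sq_sqrt h1.le]
      simp_rw [hn, mul_pow]
      rw [← Finset.sum_mul]
      field_simp
    · refine (tendsto_quadratic_sub (Mhat := fun a => Matrix.of fun j k =>
        (n a : ℝ)⁻¹ * ∑ i, g a i j * g a i k) (M := M) hM hz).congr' ?_
      filter_upwards [hpos] with a h1
      congr 1
      simp only [Matrix.of_apply]
      rw [← average_sq_eq_quadratic]
      simp_rw [hδ a h1, real_inner_smul_right, mul_pow, inv_pow, Real.sq_sqrt h1.le]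
      rw [← Finset.mul_sum]
      field_simp

end QuadraticForm

/-! ### Independent samples: maxima, Markov's inequality and the law of large numbers. -/

section Samples

variable {X : Type*} [MeasurableSpace X] (P : Measure X) [IsProbabilityMeasure P]

lemma measurePreserving_num (Pn Pd : Measure X) [IsProbabilityMeasure Pn] [IsProbabilityMeasure Pd]
    (mn md : ℕ) :
    MeasurePreserving Prod.fst (sampleLaw Pn Pd mn md) (Measure.pi fun _ : Fin mn => Pn) :=
  measurePreserving_fst

lemma measurePreserving_den (Pn Pd : Measure X) [IsProbabilityMeasure Pn] [IsProbabilityMeasure Pd]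
    (mn md : ℕ) :
    MeasurePreserving Prod.snd (sampleLaw Pn Pd mn md) (Measure.pi fun _ : Fin md => Pd) :=
  measurePreserving_snd

/-- An inequality suffices for events of small probability, and unlike equality it needs no
measurability of `s`. -/
lemma measure_preimage_le_of_measurePreserving {α β : Type*} [MeasurableSpace α]
    [MeasurableSpace β] {μ : Measure α} {ν : Measure β} {f : α → β} (hf : MeasurePreserving f μ ν)
    (s : Set β) : μ (f ⁻¹' s) ≤ ν s := by
  have h := Measure.le_map_apply (μ := μ) hf.measurable.aemeasurable s
  rwa [hf.map_eq] at h

lemma pi_exists_mem_le (n : ℕ) (A : Set X) :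
    Measure.pi (fun _ : Fin n => P) {ω | ∃ i, ω i ∈ A} ≤ n * P A := by
  have : {ω : Fin n → X | ∃ i, ω i ∈ A} = ⋃ i, (Function.eval i) ⁻¹' A := by
    ext; simp
  rw [this]
  refine (measure_iUnion_fintype_le _ _).trans ?_
  calc _ ≤ ∑ _i : Fin n, P A := Finset.sum_le_sum fun i _ =>
        measure_preimage_le_of_measurePreserving (measurePreserving_eval (fun _ => P) i) A
    _ = _ := by simp

lemma pi_exists_mem_eq (n : ℕ) {A : Set X} (hA : MeasurableSet A) :
    Measure.pi (fun _ : Fin n => P) {ω | ∃ i, ω i ∈ A} = 1 - P Aᶜ ^ n := by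
  have : {ω : Fin n → X | ∃ i, ω i ∈ A} = (Set.univ.pi fun _ => Aᶜ)ᶜ := by
    ext; simp
  rw [this, prob_compl_eq_one_sub (MeasurableSet.univ_pi fun _ => hA.compl), Measure.pi_pi]
  simp

/-- If none of `n` independent points falls into `A n` with probability tending to one, then the
expected number of such points tends to zero. -/
lemma tendsto_mul_measure_of_exists_mem {n : ℕ → ℕ} {Q : ℕ → Measure X}
    [∀ N, IsProbabilityMeasure (Q N)] {A : ℕ → Set X} (hA : ∀ N, MeasurableSet (A N))
    (h : Tendsto (fun N => Measure.pi (fun _ : Fin (n N) => Q N) {ω | ∃ i, ω i ∈ A N})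
      atTop (𝓝 0)) :
    Tendsto (fun N => n N * (Q N (A N)).toReal) atTop (𝓝 0) := by
  have h1 : Tendsto (fun N => 1 - (1 - (Q N (A N)).toReal) ^ n N) atTop (𝓝 0) := by
    have h2 := (ENNReal.tendsto_toReal ENNReal.zero_ne_top).comp h
    refine h2.congr fun N => ?_
    simp only [Function.comp]
    rw [pi_exists_mem_eq _ _ (hA N), ENNReal.toReal_sub_of_le
      (pow_le_one₀ zero_le prob_le_one) ENNReal.one_ne_top, ENNReal.toReal_pow,
      ENNReal.toReal_one, prob_compl_eq_one_sub (hA N), ENNReal.toReal_sub_of_le prob_le_one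
      ENNReal.one_ne_top, ENNReal.toReal_one]
  -- From `1 - q ≤ exp (-q)` the hitting probability `1 - (1 - q) ^ n` is at least `1 - exp (-n q)`;
  -- taking logarithms then gives `n q → 0`.
  have h3 : Tendsto (fun N => 1 - Real.exp (-(n N * (Q N (A N)).toReal))) atTop (𝓝 0) := by
    refine tendsto_of_tendsto_of_tendsto_of_le_of_le tendsto_const_nhds h1 (fun N => ?_)
      (fun N => ?_)
    · simp only [sub_nonneg, Real.exp_le_one_iff]
      simp only [Left.neg_nonpos_iff]
      positivity
    · simp only
      gcongr
      have hq : (Q N (A N)).toReal ≤ 1 :=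
        ENNReal.toReal_le_of_le_ofReal zero_le_one (by simpa using prob_le_one)
      calc _ ≤ Real.exp (-(Q N (A N)).toReal) ^ n N := by
            refine pow_le_pow_left₀ (by linarith) ?_ _
            have := Real.add_one_le_exp (-(Q N (A N)).toReal)
            linarith
        _ = _ := by rw [← Real.exp_nat_mul]; ring_nf
  have h4 : Tendsto (fun N => Real.exp (-(n N * (Q N (A N)).toReal))) atTop (𝓝 1) := by
    simpa using h3.const_sub 1
  have h5 := (h4.log one_ne_zero).neg
  simpa using h5

lemma lintegral_average (n : ℕ) {f : X → ENNReal} (hf : AEMeasurable f P) :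
    ∫⁻ ω, ∑ i, f (ω i) ∂(Measure.pi fun _ : Fin n => P) = n * ∫⁻ x, f x ∂P := by
  have hmp : ∀ i : Fin n, MeasurePreserving (Function.eval i) (Measure.pi fun _ : Fin n => P) P :=
    fun i => measurePreserving_eval _ i
  have hae : ∀ i : Fin n, AEMeasurable (fun ω : Fin n → X => f (ω i))
      (Measure.pi fun _ : Fin n => P) := fun i =>
    hf.comp_quasiMeasurePreserving (hmp i).quasiMeasurePreserving
  rw [lintegral_finsetSum' _ fun i _ => hae i]
  have : ∀ i : Fin n, ∫⁻ ω, f (ω i) ∂(Measure.pi fun _ : Fin n => P) = ∫⁻ x, f x ∂P := fun i => by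
    have h := lintegral_map' (f := f) (g := Function.eval i)
      (μ := Measure.pi fun _ : Fin n => P) (by rw [(hmp i).map_eq]; exact hf)
      (hmp i).measurable.aemeasurable
    rw [(hmp i).map_eq] at h
    exact h.symm
  simp [this]

/-- Markov's inequality for the average of a nonnegative function over a sample. -/
lemma pi_average_ge_le (n : ℕ) {f : X → ℝ} (hf : AEMeasurable f P) (hf0 : ∀ x, 0 ≤ f x)
    {t : ℝ} (ht : 0 < t) :
    Measure.pi (fun _ : Fin n => P) {ω | t ≤ (n : ℝ)⁻¹ * ∑ i, f (ω i)}
      ≤ (∫⁻ x, ENNReal.ofReal (f x) ∂P) / ENNReal.ofReal t := by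
  -- For the empty sample the average is `0` by the convention `0⁻¹ = 0`, and `t > 0` makes the
  -- event empty.
  rcases Nat.eq_zero_or_pos n with rfl | hn
  · have : {ω : Fin 0 → X | t ≤ ((0 : ℕ) : ℝ)⁻¹ * ∑ i, f (ω i)} = ∅ := by
      ext; simpa using ht
    rw [this, measure_empty]
    exact zero_le
  have hn' : (0 : ℝ) < n := by exact_mod_cast hn
  have hae : AEMeasurable (fun ω : Fin n → X => ∑ i, ENNReal.ofReal (f (ω i)))
      (Measure.pi fun _ : Fin n => P) := by
    refine Finset.aemeasurable_fun_sum _ fun i _ => AEMeasurable.ennreal_ofReal ?_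
    exact hf.comp_quasiMeasurePreserving (measurePreserving_eval _ i).quasiMeasurePreserving
  calc _ ≤ Measure.pi (fun _ : Fin n => P)
          {ω | ENNReal.ofReal (n * t) ≤ ∑ i, ENNReal.ofReal (f (ω i))} := measure_mono fun ω hω => by
        have hω : t ≤ (n : ℝ)⁻¹ * ∑ i, f (ω i) := hω
        simp only [Set.mem_ofPred_eq]
        rw [← ENNReal.ofReal_sum_of_nonneg fun i _ => hf0 _]
        refine ENNReal.ofReal_le_ofReal ?_
        rwa [inv_mul_eq_div, le_div_iff₀ hn', mul_comm] at hω
    _ ≤ (∫⁻ ω, ∑ i, ENNReal.ofReal (f (ω i)) ∂(Measure.pi fun _ : Fin n => P))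
          / ENNReal.ofReal (n * t) := meas_ge_le_lintegral_div hae
          (ENNReal.ofReal_pos.2 (by positivity)).ne' ENNReal.ofReal_ne_top
    _ = _ := by
        rw [lintegral_average P n hf.ennreal_ofReal, ENNReal.ofReal_mul hn'.le, ENNReal.ofReal_natCast,
          ENNReal.mul_div_mul_left _ _ (by simp; omega) (by simp)]

/-- The weak law of large numbers for the samples. -/
lemma pi_weak_law {f : X → ℝ} (hfm : Measurable f) (hf : Integrable f P) {ε : ℝ} (hε : 0 < ε) :
    Tendsto (fun n : ℕ => Measure.pi (fun _ : Fin n => P)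
      {ω | ε < |(n : ℝ)⁻¹ * ∑ i, f (ω i) - ∫ x, f x ∂P|}) atTop (𝓝 0) := by
  -- All sample sizes are realized on one infinite product space, where the strong law applies; the
  -- first `n` coordinates have the law of the sample of size `n`.
  set Q : Measure (ℕ → X) := Measure.infinitePi fun _ => P with hQ
  have hmp : ∀ i, MeasurePreserving (Function.eval i) Q P := fun i =>
    measurePreserving_eval_infinitePi _ i
  have hint : Integrable (fun ω : ℕ → X => f (ω 0)) Q := (hmp 0).integrable_comp_of_integrable hf
  have hlaw := strong_law_ae (μ := Q) (fun i ω => f (ω i)) hint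
    (fun i j hij => (iIndepFun_infinitePi (P := fun _ : ℕ => P) (X := fun _ => f)
      (fun _ => hfm)).indepFun hij)
    (fun i => ⟨(hfm.comp (measurable_pi_apply i)).aemeasurable,
      (hfm.comp (measurable_pi_apply 0)).aemeasurable, by
        have h1 := Measure.map_map (μ := Q) hfm (measurable_pi_apply i)
        have h2 := Measure.map_map (μ := Q) hfm (measurable_pi_apply 0)
        change Q.map (f ∘ fun ω => ω i) = Q.map (f ∘ fun ω => ω 0)
        rw [← h1, ← h2]
        exact congrArg _ ((hmp i).map_eq.trans (hmp 0).map_eq.symm)⟩)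
  have hmean : ∫ ω, f (ω 0) ∂Q = ∫ x, f x ∂P := by
    have := integral_map (μ := Q) (f := f) (φ := Function.eval 0)
      (measurable_pi_apply 0).aemeasurable hfm.aestronglyMeasurable
    rw [(hmp 0).map_eq] at this
    exact this.symm
  rw [hmean] at hlaw
  have hmeas : ∀ n : ℕ, AEStronglyMeasurable
      (fun ω : ℕ → X => (n : ℝ)⁻¹ • ∑ i ∈ Finset.range n, f (ω i)) Q := fun n => by
    refine Measurable.aestronglyMeasurable ?_
    have h1 : Measurable fun ω : ℕ → X => ∑ i ∈ Finset.range n, f (ω i) :=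
      Finset.measurable_fun_sum _ fun i _ => hfm.comp (measurable_pi_apply i)
    exact h1.const_mul _
  have hin := tendstoInMeasure_of_tendsto_ae hmeas hlaw
  rw [tendstoInMeasure_iff_norm] at hin
  refine tendsto_of_tendsto_of_tendsto_of_le_of_le tendsto_const_nhds (hin ε hε)
    (fun _ => zero_le) fun n => ?_
  have hproj : Measurable (fun (ω : ℕ → X) (i : Fin n) => ω i) :=
    measurable_pi_lambda _ fun i => measurable_pi_apply _
  have hmpn : MeasurePreserving (fun (ω : ℕ → X) (i : Fin n) => ω i) Q
      (Measure.pi fun _ : Fin n => P) := by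
    refine ⟨hproj, ?_⟩
    refine (Measure.pi_eq fun s hs => ?_).symm
    rw [Measure.map_apply hproj (MeasurableSet.univ_pi hs)]
    have : (fun (ω : ℕ → X) (i : Fin n) => ω i) ⁻¹' Set.univ.pi s
        = Set.pi (Finset.range n : Set ℕ)
          fun i => if h : i < n then s ⟨i, h⟩ else Set.univ := by
      ext ω
      simp only [Set.mem_preimage, Set.mem_pi, Set.mem_univ, true_implies, Finset.coe_range,
        Set.mem_Iio]
      constructor
      · intro h i hi
        simpa [hi] using h ⟨i, hi⟩
      · intro h i
        simpa using h i i.2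
    rw [this, hQ, Measure.infinitePi_pi]
    · rw [← Fin.prod_univ_eq_prod_range
        (fun i => P (if h : i < n then s ⟨i, h⟩ else Set.univ)) n]
      simp
    · intro i _
      split_ifs with h
      · exact hs _
      · exact MeasurableSet.univ
  rw [← hmpn.measure_preimage]
  · refine measure_mono fun ω hω => ?_
    simp only [Set.mem_preimage, Set.mem_ofPred_eq] at hω ⊢
    rw [Real.norm_eq_abs, smul_eq_mul, ← Fin.sum_univ_eq_sum_range (fun i => f (ω i)) n]
    exact hω.le
  · refine (measurableSet_lt measurable_const ?_).nullMeasurableSet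
    have h1 : Measurable fun ω : Fin n → X => ∑ i, f (ω i) :=
      Finset.measurable_fun_sum _ fun i _ => hfm.comp (measurable_pi_apply i)
    exact ((h1.const_mul _).sub_const _).abs

end Samples

/-- For an integrable `f`, `t P(f > t) → 0`. -/
lemma tendsto_mul_measure_gt {X : Type*} [MeasurableSpace X] (P : Measure X) {f : X → ℝ} (hfm : Measurable f) (hf : Integrable f P)
    {t : ℕ → ℝ} (ht : Tendsto t atTop atTop) :
    Tendsto (fun N => t N * (P {x | t N < f x}).toReal) atTop (𝓝 0) := by
  have hset : ∀ N, MeasurableSet {x | t N < f x} := fun N => measurableSet_lt measurable_const hfm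
  -- The functions `t · 1_{f > t}` are dominated by `|f|` once `t ≥ 0` and vanish at each point once
  -- `t ≥ f x`.
  have h := tendsto_integral_filter_of_dominated_convergence (μ := P) (l := atTop)
    (F := fun N => {x | t N < f x}.indicator fun _ => t N) (f := fun _ => 0) (fun x => |f x|)
    (Eventually.of_forall fun N => (measurable_const.indicator (hset N)).aestronglyMeasurable)
    ?_ hf.abs ?_
  · simp only [integral_zero] at h
    refine h.congr fun N => ?_
    rw [integral_indicator_const _ (hset N), smul_eq_mul, mul_comm]
    rfl
  · filter_upwards [ht.eventually_ge_atTop 0] with N hN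
    refine ae_of_all _ fun x => ?_
    by_cases hx : x ∈ {x | t N < f x}
    · rw [Set.indicator_of_mem hx, Real.norm_of_nonneg hN]
      exact (le_of_lt hx).trans (le_abs_self _)
    · rw [Set.indicator_of_notMem hx]
      simp
  · refine ae_of_all _ fun x => ?_
    refine tendsto_const_nhds.congr' ?_
    filter_upwards [ht.eventually_ge_atTop (f x)] with N hN
    rw [Set.indicator_of_notMem]
    simpa using hN

/-! ### Local alternatives: tails of the score and orthogonality of the local parameter. -/

section LocalDensity

variable {X : Type*} [MeasurableSpace X] {d : ℕ}

/-- Probability measures `Q N` with density `exp (s N)` with respect to `P`, whose logarithmic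
density ratios are linear at the scale `(√m)⁻¹`, with score `g` and local parameter `h`. -/
structure LocalDensity (P : Measure X) (g : X → EuclideanSpace ℝ (Fin d)) (K : X → ℝ)
    (s : ℕ → X → ℝ) (Q : ℕ → Measure X) (m : ℕ → ℝ) (n : ℕ → ℕ)
    (h : ℕ → EuclideanSpace ℝ (Fin d)) (hlim : EuclideanSpace ℝ (Fin d)) : Prop where
  isProbabilityMeasure : ∀ N, IsProbabilityMeasure (Q N)
  measurable_score : Measurable g
  memLp_score : MemLp g 2 P
  memLp_remainder : MemLp K 2 P
  measurable_log : ∀ N, Measurable (s N)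
  eq_withDensity : ∀ N, Q N = P.withDensity fun x => ENNReal.ofReal (Real.exp (s N x))
  tendsto_atTop : Tendsto m atTop atTop
  size_le : ∃ C : ℝ, ∀ᶠ N in atTop, (n N : ℝ) ≤ C * m N
  le_size : ∀ N, m N ≤ n N
  tendsto_param : Tendsto h atTop (𝓝 hlim)
  approx : ∀ᶠ N in atTop, ∀ x, |s N x - inner ℝ (g x) ((√(m N))⁻¹ • h N)|
    ≤ |K x| * ‖(√(m N))⁻¹ • h N‖ ^ 2
  remainder_bdd : ∃ C : NNReal, ∀ᶠ N in atTop, ∫⁻ x, ENNReal.ofReal (K x ^ 2) ∂(Q N) ≤ C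
  -- A single constant is required here; `tendsto_score` upgrades it to every positive `ε`.
  large_score : ∃ L > (0 : ℝ),
    Tendsto (fun N => n N * (Q N {x | L * m N < ‖g x‖ ^ 2}).toReal) atTop (𝓝 0)

/-- An upper bound on `s` alone suffices; this is the domination available after truncating the log
density ratio from above. -/
lemma abs_exp_sub_one_le_of_le {s C : ℝ} (hC : 0 ≤ C) (hs : s ≤ C) :
    |Real.exp s - 1| ≤ Real.exp C * |s| := by
  have h1 : 1 ≤ Real.exp C := Real.one_le_exp hC
  have h2 := Real.add_one_le_exp s
  have h3 := Real.add_one_le_exp (-s)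
  rcases le_total 0 s with h | h
  · rw [abs_of_nonneg h, abs_of_nonneg (by linarith)]
    have h4 : Real.exp s - 1 ≤ Real.exp s * s := by
      have h5 : Real.exp s * Real.exp (-s) = 1 := by rw [← Real.exp_add]; simp
      nlinarith [Real.exp_pos s]
    exact h4.trans (by gcongr)
  · rw [abs_of_nonpos h, abs_of_nonpos (by have := Real.exp_le_one_iff.2 h; linarith)]
    nlinarith

lemma tendsto_size_mul_zero {m : ℕ → ℝ} {n : ℕ → ℕ} {p : ℕ → ℝ} (hp : ∀ N, 0 ≤ p N)
    (hn : ∃ C : ℝ, ∀ᶠ N in atTop, (n N : ℝ) ≤ C * m N)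
    (h : Tendsto (fun N => m N * p N) atTop (𝓝 0)) :
    Tendsto (fun N => n N * p N) atTop (𝓝 0) := by
  obtain ⟨C, hC⟩ := hn
  have h2 := h.const_mul C
  rw [mul_zero] at h2
  refine tendsto_of_tendsto_of_tendsto_of_le_of_le' tendsto_const_nhds h2
    (Eventually.of_forall fun N => mul_nonneg (Nat.cast_nonneg _) (hp N)) ?_
  filter_upwards [hC] with N hN
  rw [← mul_assoc]
  exact mul_le_mul_of_nonneg_right hN (hp N)

/-- A function with bounded second moments exceeds `ε m` with probability `o(1/n)`. -/
lemma tendsto_size_mul_measure_remainder {Q : ℕ → Measure X} [∀ N, IsProbabilityMeasure (Q N)]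
    {K : X → ℝ} {m : ℕ → ℝ} {n : ℕ → ℕ} (hK : ∀ N, AEMeasurable K (Q N))
    (hm : Tendsto m atTop atTop) (hn : ∃ C : ℝ, ∀ᶠ N in atTop, (n N : ℝ) ≤ C * m N)
    (hbdd : ∃ C : NNReal, ∀ᶠ N in atTop, ∫⁻ x, ENNReal.ofReal (K x ^ 2) ∂(Q N) ≤ C)
    {ε : ℝ} (hε : 0 < ε) :
    Tendsto (fun N => n N * (Q N {x | ε * m N < |K x|}).toReal) atTop (𝓝 0) := by
  refine tendsto_size_mul_zero (fun _ => ENNReal.toReal_nonneg) hn ?_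
  obtain ⟨C, hC⟩ := hbdd
  have hlim : Tendsto (fun N => (C / ε ^ 2) * (m N)⁻¹) atTop (𝓝 0) := by
    simpa using (tendsto_inv_atTop_zero.comp hm).const_mul (C / ε ^ 2 : ℝ)
  refine tendsto_of_tendsto_of_tendsto_of_le_of_le' tendsto_const_nhds hlim ?_ ?_
  · filter_upwards [hm.eventually_ge_atTop 0] with N hN
    positivity
  filter_upwards [hC, hm.eventually_gt_atTop 0] with N h1 h2
  have h3 : Q N {x | ε * m N < |K x|} ≤ C / ENNReal.ofReal ((ε * m N) ^ 2) := by
    calc _ ≤ Q N {x | ENNReal.ofReal ((ε * m N) ^ 2) ≤ ENNReal.ofReal (K x ^ 2)} := by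
          refine measure_mono fun x hx => ENNReal.ofReal_le_ofReal ?_
          rw [← sq_abs (K x)]
          have : ε * m N < |K x| := hx
          gcongr
      _ ≤ (∫⁻ x, ENNReal.ofReal (K x ^ 2) ∂(Q N)) / ENNReal.ofReal ((ε * m N) ^ 2) :=
          meas_ge_le_lintegral_div ((hK N).pow_const 2).ennreal_ofReal
            (ENNReal.ofReal_pos.2 (by positivity)).ne' ENNReal.ofReal_ne_top
      _ ≤ _ := by gcongr
  have h4 : (Q N {x | ε * m N < |K x|}).toReal ≤ C / (ε * m N) ^ 2 := by
    refine ENNReal.toReal_le_of_le_ofReal (by positivity) (h3.trans_eq ?_)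
    rw [ENNReal.ofReal_div_of_pos (by positivity), ENNReal.ofReal_coe_nnreal]
  calc _ ≤ m N * (C / (ε * m N) ^ 2) := by gcongr
    _ = _ := by field_simp

namespace LocalDensity

variable {P : Measure X} {g : X → EuclideanSpace ℝ (Fin d)} {K : X → ℝ}
    {s : ℕ → X → ℝ} {Q : ℕ → Measure X} {m : ℕ → ℝ} {n : ℕ → ℕ}
    {h : ℕ → EuclideanSpace ℝ (Fin d)} {hlim : EuclideanSpace ℝ (Fin d)}

lemma absolutelyContinuous (H : LocalDensity P g K s Q m n h hlim) (N : ℕ) : Q N ≪ P := by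
  rw [H.eq_withDensity]
  exact withDensity_absolutelyContinuous _ _

lemma measure_eq (H : LocalDensity P g K s Q m n h hlim) (N : ℕ) {A : Set X}
    (hA : MeasurableSet A) : Q N A = ∫⁻ x in A, ENNReal.ofReal (Real.exp (s N x)) ∂P := by
  rw [H.eq_withDensity, withDensity_apply _ hA]

lemma tendsto_remainder (H : LocalDensity P g K s Q m n h hlim) {ε : ℝ} (hε : 0 < ε) :
    Tendsto (fun N => n N * (Q N {x | ε * m N < |K x|}).toReal) atTop (𝓝 0) :=
  have := H.isProbabilityMeasure
  tendsto_size_mul_measure_remainder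
    (fun N => H.memLp_remainder.aestronglyMeasurable.aemeasurable.mono_ac
      (H.absolutelyContinuous N)) H.tendsto_atTop H.size_le H.remainder_bdd hε

/-- Off the sets `‖g‖² > L m` and `|K| > m`, each of `Q N`-probability `o(1/n)`, Cauchy–Schwarz
bounds the linear part of the log density by `√L * B` and its remainder by `B²`. -/
lemma tendsto_log_large (H : LocalDensity P g K s Q m n h hlim) :
    ∃ C > (0 : ℝ), Tendsto (fun N => n N * (Q N {x | C < s N x}).toReal) atTop (𝓝 0) := by
  have := H.isProbabilityMeasure
  obtain ⟨L, hL, hlarge⟩ := H.large_score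
  set B := ‖hlim‖ + 1
  have hB : ∀ᶠ N in atTop, ‖h N‖ ≤ B :=
    (H.tendsto_param.norm.eventually (gt_mem_nhds (lt_add_one _))).mono fun _ h => h.le
  have hB0 : 0 ≤ B := by positivity
  refine ⟨√L * B + B ^ 2, by positivity, ?_⟩
  have hlim := hlarge.add (H.tendsto_remainder one_pos)
  rw [add_zero] at hlim
  refine tendsto_of_tendsto_of_tendsto_of_le_of_le' tendsto_const_nhds hlim
    (Eventually.of_forall fun N => by positivity) ?_
  filter_upwards [hB, H.approx, H.tendsto_atTop.eventually_gt_atTop 0] with N h1 h2 h3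
  rw [← mul_add]
  gcongr
  rw [← ENNReal.toReal_add (measure_ne_top _ _) (measure_ne_top _ _)]
  refine ENNReal.toReal_mono (ENNReal.add_ne_top.2 ⟨measure_ne_top _ _, measure_ne_top _ _⟩) ?_
  refine (measure_mono fun x hx => ?_).trans (measure_union_le _ _)
  by_contra hcon
  simp only [Set.mem_union, Set.mem_ofPred_eq, not_or, not_lt, one_mul] at hcon hx
  obtain ⟨c1, c2⟩ := hcon
  refine absurd hx (not_lt.2 ?_)
  have hsm : 0 < √(m N) := Real.sqrt_pos.2 h3
  have hδ : ‖(√(m N))⁻¹ • h N‖ ≤ (√(m N))⁻¹ * B := by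
    rw [norm_smul, norm_inv, Real.norm_of_nonneg hsm.le]
    gcongr
  have hgn : ‖g x‖ ≤ √L * √(m N) := by
    rw [← Real.sqrt_mul hL.le]
    exact Real.le_sqrt_of_sq_le c1
  have e1 : inner ℝ (g x) ((√(m N))⁻¹ • h N) ≤ √L * B := by
    calc _ ≤ ‖g x‖ * ‖(√(m N))⁻¹ • h N‖ := real_inner_le_norm _ _
      _ ≤ (√L * √(m N)) * ((√(m N))⁻¹ * B) := by gcongr
      _ = _ := by field_simp
  have e2 : |K x| * ‖(√(m N))⁻¹ • h N‖ ^ 2 ≤ B ^ 2 := by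
    calc _ ≤ m N * ((√(m N))⁻¹ * B) ^ 2 := by gcongr
      _ = B ^ 2 := by rw [mul_pow, inv_pow, Real.sq_sqrt h3.le]; field_simp
  have := (le_abs_self _).trans (h2 x)
  linarith

variable [IsProbabilityMeasure P]

/-- Under local alternatives, the score exceeds `√(ε m)` with probability `o(1/n)`. -/
lemma tendsto_score (H : LocalDensity P g K s Q m n h hlim) {ε : ℝ} (hε : 0 < ε) :
    Tendsto (fun N => n N * (Q N {x | ε * m N < ‖g x‖ ^ 2}).toReal) atTop (𝓝 0) := by
  have := H.isProbabilityMeasure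
  obtain ⟨C, hC, hlog⟩ := H.tendsto_log_large
  -- Under the fixed law `P` this is integrability of `‖g‖²`, as `n` is of order at most `m`.
  have hnull : Tendsto (fun N => n N * (P {x | ε * m N < ‖g x‖ ^ 2}).toReal) atTop (𝓝 0) := by
    refine tendsto_size_mul_zero (fun _ => ENNReal.toReal_nonneg) H.size_le ?_
    have h2 := (tendsto_mul_measure_gt P (f := fun x => ‖g x‖ ^ 2)
      (H.measurable_score.norm.pow_const 2) (H.memLp_score.integrable_norm_pow two_ne_zero)
      (H.tendsto_atTop.const_mul_atTop hε)).const_mul ε⁻¹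
    rw [mul_zero] at h2
    refine h2.congr fun N => ?_
    field_simp
  have hsum := (hnull.const_mul (Real.exp C)).add hlog
  rw [mul_zero, add_zero] at hsum
  refine tendsto_of_tendsto_of_tendsto_of_le_of_le tendsto_const_nhds hsum
    (fun N => by positivity) fun N => ?_
  have hA : MeasurableSet {x | ε * m N < ‖g x‖ ^ 2} :=
    measurableSet_lt measurable_const (H.measurable_score.norm.pow_const 2)
  have hS : MeasurableSet {x | C < s N x} := measurableSet_lt measurable_const (H.measurable_log N)
  set A := {x | ε * m N < ‖g x‖ ^ 2}
  set S := {x | C < s N x}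
  -- Change of measure: outside `S` the density is at most `exp C`, and `S` itself has `Q
  -- N`-probability `o(1/n)`.
  have h1 : Q N A ≤ ENNReal.ofReal (Real.exp C) * P A + Q N S := by
    calc Q N A ≤ Q N ((A \ S) ∪ S) := measure_mono (by
          rw [Set.sdiff_union_self]; exact Set.subset_union_left)
      _ ≤ Q N (A \ S) + Q N S := measure_union_le _ _
      _ ≤ _ := by
        gcongr
        rw [H.measure_eq N (hA.diff hS)]
        calc _ ≤ ∫⁻ _x in A \ S, ENNReal.ofReal (Real.exp C) ∂P := by
              refine setLIntegral_mono measurable_const fun x hx => ENNReal.ofReal_le_ofReal ?_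
              exact Real.exp_le_exp.2 (not_lt.1 hx.2)
          _ = ENNReal.ofReal (Real.exp C) * P (A \ S) := by simp
          _ ≤ _ := by gcongr; exact Set.sdiff_subset
  have h2 : (Q N A).toReal ≤ Real.exp C * (P A).toReal + (Q N S).toReal := by
    have h3 := ENNReal.toReal_mono (ENNReal.add_ne_top.2
      ⟨ENNReal.mul_ne_top ENNReal.ofReal_ne_top (measure_ne_top _ _), measure_ne_top _ _⟩) h1
    rwa [ENNReal.toReal_add (ENNReal.mul_ne_top ENNReal.ofReal_ne_top (measure_ne_top _ _))
      (measure_ne_top _ _), ENNReal.toReal_mul, ENNReal.toReal_ofReal (Real.exp_pos C).le] at h3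
  calc _ ≤ n N * (Real.exp C * (P A).toReal + (Q N S).toReal) := by gcongr
    _ = _ := by ring

/-- Since the local alternatives are probability measures, the local parameter is orthogonal to
the mean of the score. -/
lemma integral_inner_eq_zero (H : LocalDensity P g K s Q m n h hlim) :
    ∫ x, inner ℝ (g x) hlim ∂P = 0 := by
  have := H.isProbabilityMeasure
  obtain ⟨C, hC, hlog⟩ := H.tendsto_log_large
  set B := ‖hlim‖ + 1
  have hB : ∀ᶠ N in atTop, ‖h N‖ ≤ B :=
    (H.tendsto_param.norm.eventually (gt_mem_nhds (lt_add_one _))).mono fun _ h => h.le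
  have hB0 : 0 ≤ B := by positivity
  have hsm : Tendsto (fun N => √(m N)) atTop atTop := Real.tendsto_sqrt_atTop.comp H.tendsto_atTop
  have hS : ∀ N, MeasurableSet {x | s N x ≤ C} := fun N =>
    measurableSet_le (H.measurable_log N) measurable_const
  have hS' : ∀ N, {x | s N x ≤ C}ᶜ = {x | C < s N x} := fun N => by ext; simp
  have happ : ∀ᶠ N in atTop, ∀ x, |√(m N) * s N x - inner ℝ (g x) (h N)|
      ≤ |K x| * B ^ 2 * (√(m N))⁻¹ := by
    filter_upwards [H.approx, hB, H.tendsto_atTop.eventually_gt_atTop 0] with N h1 h2 h3 x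
    have hpos : 0 < √(m N) := Real.sqrt_pos.2 h3
    have h4 := h1 x
    rw [real_inner_smul_right, norm_smul, norm_inv, Real.norm_of_nonneg hpos.le] at h4
    calc _ = √(m N) * |s N x - (√(m N))⁻¹ * inner ℝ (g x) (h N)| := by
          rw [← abs_of_pos hpos, ← abs_mul, abs_of_pos hpos, mul_sub, mul_inv_cancel_left₀ hpos.ne']
      _ ≤ √(m N) * (|K x| * ((√(m N))⁻¹ * B) ^ 2) := by
          gcongr
          exact h4.trans (by gcongr)
      _ = _ := by field_simp
  have hscaled : ∀ x, Tendsto (fun N => √(m N) * s N x) atTop (𝓝 (inner ℝ (g x) hlim)) := by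
    intro x
    have h1 : Tendsto (fun N => |K x| * B ^ 2 * (√(m N))⁻¹) atTop (𝓝 0) := by
      simpa using (tendsto_inv_atTop_zero.comp hsm).const_mul (|K x| * B ^ 2)
    have h2 : Tendsto (fun N => √(m N) * s N x - inner ℝ (g x) (h N)) atTop (𝓝 0) :=
      squeeze_zero_norm' (happ.mono fun N h => h x) h1
    have h3 := h2.add (tendsto_const_nhds.inner H.tendsto_param : Tendsto (fun N =>
      inner ℝ (g x) (h N)) atTop (𝓝 (inner ℝ (g x) hlim)))
    simpa using h3
  have hs0 : ∀ x, Tendsto (fun N => s N x) atTop (𝓝 0) := by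
    intro x
    have h1 := (tendsto_inv_atTop_zero.comp hsm).mul (hscaled x)
    rw [zero_mul] at h1
    refine h1.congr' ?_
    filter_upwards [hsm.eventually_gt_atTop 0] with N hN
    simp only [Function.comp]
    field_simp
  -- The identity `∫ (exp s − 1) dP = 0` is multiplied by `√m` and truncated to `s ≤ C`: the
  -- truncated integrand has an integrable majorant and tends to `⟪g, hlim⟫`, and the truncation
  -- error is negligible.
  set F : ℕ → X → ℝ := fun N => {x | s N x ≤ C}.indicator fun x => √(m N) * (Real.exp (s N x) - 1)
  have hFm : ∀ N, Measurable (F N) := fun N =>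
    (((H.measurable_log N).exp.sub_const 1).const_mul _).indicator (hS N)
  have hdct : Tendsto (fun N => ∫ x, F N x ∂P) atTop (𝓝 (∫ x, inner ℝ (g x) hlim ∂P)) := by
    refine tendsto_integral_filter_of_dominated_convergence
      (fun x => Real.exp C * (‖g x‖ * B + |K x| * B ^ 2))
      (Eventually.of_forall fun N => (hFm N).aestronglyMeasurable) ?_ ?_ ?_
    · filter_upwards [happ, hB, hsm.eventually_ge_atTop 1] with N h1 h2 h3
      refine ae_of_all _ fun x => ?_
      have hpos : 0 < √(m N) := by linarith
      by_cases hx : s N x ≤ C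
      · have : F N x = √(m N) * (Real.exp (s N x) - 1) := Set.indicator_of_mem (s := {x | s N x ≤ C}) hx _
        rw [this, Real.norm_eq_abs, abs_mul, abs_of_pos hpos]
        have h4 : |√(m N) * s N x| ≤ ‖g x‖ * B + |K x| * B ^ 2 := by
          have h5 := abs_sub_abs_le_abs_sub (√(m N) * s N x) (inner ℝ (g x) (h N))
          have h6 : |inner ℝ (g x) (h N)| ≤ ‖g x‖ * B :=
            (abs_real_inner_le_norm _ _).trans (by gcongr)
          have h7 : |K x| * B ^ 2 * (√(m N))⁻¹ ≤ |K x| * B ^ 2 :=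
            mul_le_of_le_one_right (by positivity) (inv_le_one_of_one_le₀ h3)
          have := h1 x
          linarith
        calc _ ≤ √(m N) * (Real.exp C * |s N x|) := by
              gcongr; exact abs_exp_sub_one_le_of_le hC.le hx
          _ = Real.exp C * |√(m N) * s N x| := by rw [abs_mul, abs_of_pos hpos]; ring
          _ ≤ _ := by gcongr
      · have : F N x = 0 := Set.indicator_of_notMem (s := {x | s N x ≤ C}) hx _
        rw [this, norm_zero]
        positivity
    · exact (((H.memLp_score.integrable one_le_two).norm.mul_const _).add
        ((H.memLp_remainder.integrable one_le_two).abs.mul_const _)).const_mul _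
    · refine ae_of_all _ fun x => ?_
      have hexp : Tendsto (fun N => √(m N) * (Real.exp (s N x) - 1)) atTop
          (𝓝 (inner ℝ (g x) hlim)) := by
        -- `dslope` extends `(exp s − 1) / s` continuously to `s = 0`, so points where `s` vanishes
        -- need no separate case.
        have hd : Tendsto (dslope Real.exp 0) (𝓝 0) (𝓝 1) := by
          have := (continuousAt_dslope_same.2 (Real.differentiableAt_exp (x := 0))).tendsto
          simpa [dslope_same] using this
        have h1 := (hscaled x).mul (hd.comp (hs0 x))
        rw [mul_one] at h1
        refine h1.congr fun N => ?_
        have := sub_smul_dslope Real.exp 0 (s N x)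
        simp only [sub_zero, smul_eq_mul, Real.exp_zero] at this
        rw [Function.comp, mul_assoc, this]
      refine hexp.congr' ?_
      filter_upwards [(hs0 x).eventually (ge_mem_nhds hC)] with N hN
      exact (Set.indicator_of_mem (s := {x | s N x ≤ C}) hN
        fun x => √(m N) * (Real.exp (s N x) - 1)).symm
  -- Both laws have mass one, so the integral equals `√m (P(s > C) − Q(s > C))`. There the density
  -- is at least `1`, hence `P ≤ Q`, and `√m ≤ n` leaves the bound `n Q(s > C) → 0`.
  have hzero : Tendsto (fun N => ∫ x, F N x ∂P) atTop (𝓝 0) := by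
    refine squeeze_zero_norm' ?_ hlog
    filter_upwards [hsm.eventually_ge_atTop 1] with N hN
    have hm1 : √(m N) ≤ n N := by
      refine le_trans ?_ (H.le_size N)
      have h0 : 0 < m N := Real.sqrt_pos.1 (by linarith)
      nlinarith [Real.sq_sqrt h0.le]
    have hint : IntegrableOn (fun x => Real.exp (s N x)) {x | s N x ≤ C} P := by
      refine Measure.integrableOn_of_bounded (M := Real.exp C) (measure_ne_top _ _)
        (H.measurable_log N).exp.aestronglyMeasurable ?_
      refine (ae_restrict_iff' (hS N)).2 (ae_of_all _ fun x hx => ?_)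
      rw [Real.norm_of_nonneg (Real.exp_pos _).le]
      exact Real.exp_le_exp.2 hx
    have hQ : ∫ x in {x | s N x ≤ C}, Real.exp (s N x) ∂P = (Q N {x | s N x ≤ C}).toReal := by
      rw [H.measure_eq N (hS N), integral_eq_lintegral_of_nonneg_ae
        (ae_of_all _ fun x => (Real.exp_pos _).le) (H.measurable_log N).exp.aestronglyMeasurable]
    have hF : ∫ x, F N x ∂P = √(m N) * ((Q N {x | s N x ≤ C}).toReal
        - (P {x | s N x ≤ C}).toReal) := by
      simp only [F]
      rw [integral_indicator (hS N), integral_const_mul, integral_sub hint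
        (integrableOn_const (measure_ne_top _ _)), hQ]
      simp [Measure.real]
    have hcQ : (Q N {x | s N x ≤ C}).toReal = 1 - (Q N {x | C < s N x}).toReal := by
      have := prob_compl_eq_one_sub (μ := Q N) (hS N).compl
      rw [compl_compl, hS'] at this
      rw [this, ENNReal.toReal_sub_of_le prob_le_one ENNReal.one_ne_top, ENNReal.toReal_one]
    have hcP : (P {x | s N x ≤ C}).toReal = 1 - (P {x | C < s N x}).toReal := by
      have := prob_compl_eq_one_sub (μ := P) (hS N).compl
      rw [compl_compl, hS'] at this
      rw [this, ENNReal.toReal_sub_of_le prob_le_one ENNReal.one_ne_top, ENNReal.toReal_one]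
    have hle : (P {x | C < s N x}).toReal ≤ (Q N {x | C < s N x}).toReal := by
      refine ENNReal.toReal_mono (measure_ne_top _ _) ?_
      rw [H.measure_eq N (by rw [← hS']; exact (hS N).compl)]
      calc _ = ∫⁻ _x in {x | C < s N x}, 1 ∂P := by simp
        _ ≤ _ := by
          refine setLIntegral_mono (H.measurable_log N).exp.ennreal_ofReal fun x hx => ?_
          rw [← ENNReal.ofReal_one]
          exact ENNReal.ofReal_le_ofReal (Real.one_le_exp (hC.le.trans (le_of_lt hx)))
    rw [hF, hcQ, hcP, Real.norm_eq_abs, abs_mul, abs_of_nonneg (Real.sqrt_nonneg _)]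
    gcongr
    rw [abs_le]
    have : 0 ≤ (P {x | C < s N x}).toReal := ENNReal.toReal_nonneg
    constructor <;> linarith
  exact tendsto_nhds_unique hdct hzero

end LocalDensity
end LocalDensity

/-! ### The exponential model: gradients, linearization and moment matrices. -/

section Model

variable {X : Type*} {k : ℕ} {φ : X → EuclideanSpace ℝ (Fin k) → ℝ} {θs : Param k}

/-- The projection `θ ↦ β` as a continuous linear map. -/
def betaCLM (k : ℕ) : Param k →L[ℝ] EuclideanSpace ℝ (Fin k) :=
  LinearMap.toContinuousLinearMap
    { toFun := betaPart
      map_add' := fun _ _ => by ext; simp [betaPart]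
      map_smul' := fun _ _ => by ext; simp [betaPart] }

@[simp] lemma betaCLM_apply (θ : Param k) : betaCLM k θ = betaPart θ := rfl

@[simp] lemma betaPart_apply (θ : Param k) (i : Fin k) : betaPart θ i = θ i.succ := rfl

lemma betaPart_sub (θ η : Param k) : betaPart (θ - η) = betaPart θ - betaPart η :=
  map_sub (betaCLM k) θ η

lemma norm_betaPart_le (θ : Param k) : ‖betaPart θ‖ ≤ ‖θ‖ := by
  rw [EuclideanSpace.norm_eq, EuclideanSpace.norm_eq, Fin.sum_univ_succ (n := k)]
  gcongr
  simp only [betaPart_apply, le_add_iff_nonneg_left]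
  positivity

lemma log_ratio (x : X) (θ : Param k) : Real.log (ratio φ x θ) = θ 0 + φ x (betaPart θ) :=
  Real.log_exp _

lemma ratio_eq_exp_log (x : X) (θ : Param k) : ratio φ x θ = Real.exp (Real.log (ratio φ x θ)) :=
  (Real.exp_log (Real.exp_pos _)).symm

lemma hasFDerivAt_log_ratio {x : X} (hd : DifferentiableAt ℝ (φ x) (betaPart θs)) :
    HasFDerivAt (fun t => Real.log (ratio φ x t))
      (EuclideanSpace.proj 0 + (fderiv ℝ (φ x) (betaPart θs)).comp (betaCLM k)) θs := by
  simp_rw [log_ratio]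
  refine HasFDerivAt.add (EuclideanSpace.proj (𝕜 := ℝ) (0 : Fin (k + 1))).hasFDerivAt ?_
  exact HasFDerivAt.comp θs (g := φ x) (f := betaCLM k) hd.hasFDerivAt (betaCLM k).hasFDerivAt

lemma inner_gradient_left {E : Type*} [NormedAddCommGroup E] [InnerProductSpace ℝ E]
    [CompleteSpace E] (f : E → ℝ) (x v : E) : inner ℝ (gradient f x) v = fderiv ℝ f x v := by
  simp [gradient]

lemma inner_gradLogRatio {x : X} (hd : DifferentiableAt ℝ (φ x) (betaPart θs)) (v : Param k) :
    inner ℝ (gradLogRatio φ x θs) v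
      = v 0 + inner ℝ (gradient (φ x) (betaPart θs)) (betaPart v) := by
  rw [gradLogRatio, inner_gradient_left, (hasFDerivAt_log_ratio hd).fderiv, inner_gradient_left]
  simp

/-- The intercept is a coordinate of the score. This constant `1` makes row `0` of `matM` the mean
of the score and the covariance a rank-one correction of `matM`. -/
lemma gradLogRatio_zero {x : X} (hd : DifferentiableAt ℝ (φ x) (betaPart θs)) :
    gradLogRatio φ x θs 0 = 1 := by
  have h := inner_gradLogRatio hd (EuclideanSpace.single 0 1)
  have h0 : betaPart (EuclideanSpace.single 0 1 : Param k) = 0 := by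
    ext i; simp [(Fin.succ_ne_zero i)]
  rw [EuclideanSpace.inner_single_right, h0] at h
  simpa using h

lemma gradLogRatio_succ {x : X} (hd : DifferentiableAt ℝ (φ x) (betaPart θs)) (i : Fin k) :
    gradLogRatio φ x θs i.succ = gradient (φ x) (betaPart θs) i := by
  have h := inner_gradLogRatio hd (EuclideanSpace.single i.succ 1)
  have h0 : betaPart (EuclideanSpace.single i.succ 1 : Param k) = EuclideanSpace.single i 1 := by
    ext j; simp
  rw [EuclideanSpace.inner_single_right, h0, EuclideanSpace.inner_single_right] at h
  simpa [(Fin.succ_ne_zero i).symm] using h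

lemma gradRatio_eq_gradLogRatio {x : X} (hd : DifferentiableAt ℝ (φ x) (betaPart θs))
    (h1 : ratio φ x θs = 1) : gradRatio φ x θs = gradLogRatio φ x θs := by
  have h := hasFDerivAt_log_ratio hd
  have h2 : HasFDerivAt (fun t => ratio φ x t) (ratio φ x θs •
      (EuclideanSpace.proj 0 + (fderiv ℝ (φ x) (betaPart θs)).comp (betaCLM k))) θs := by
    have := h.exp
    simp only [← ratio_eq_exp_log] at this
    exact this
  rw [h1, one_smul] at h2
  rw [gradRatio, gradLogRatio, gradient, gradient, h.fderiv, h2.fderiv]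

/-- The log ratio is affine in the intercept, so the second-order error comes from `φ` alone; the
affine part cancels because the ratio is `1` at `θs`. -/
lemma eventually_log_ratio_approx (hd : ∀ x, DifferentiableAt ℝ (φ x) (betaPart θs))
    (hone : ∀ x, ratio φ x θs = 1) {K : X → ℝ}
    (hKφ : ∀ᶠ b in 𝓝 (betaPart θs), ∀ x,
      |φ x b - φ x (betaPart θs) - inner ℝ (gradient (φ x) (betaPart θs)) (b - betaPart θs)|
        ≤ K x * ‖b - betaPart θs‖ ^ 2) :
    ∀ᶠ t in 𝓝 θs, ∀ x, |Real.log (ratio φ x t) - inner ℝ (gradLogRatio φ x θs) (t - θs)|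
      ≤ |K x| * ‖t - θs‖ ^ 2 := by
  filter_upwards [(betaCLM k).continuous.continuousAt.eventually hKφ] with t ht x
  have h1 := ht x
  rw [betaCLM_apply, ← betaPart_sub] at h1
  have h0 : θs 0 + φ x (betaPart θs) = 0 := by
    rw [← log_ratio, hone x, Real.log_one]
  rw [log_ratio, inner_gradLogRatio (hd x)]
  calc _ = |φ x (betaPart t) - φ x (betaPart θs)
        - inner ℝ (gradient (φ x) (betaPart θs)) (betaPart (t - θs))| := by
        congr 1
        rw [PiLp.sub_apply]
        linarith
    _ ≤ K x * ‖betaPart (t - θs)‖ ^ 2 := h1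
    _ ≤ |K x| * ‖t - θs‖ ^ 2 := by
        gcongr
        · exact le_abs_self _
        · exact norm_betaPart_le _

variable [MeasurableSpace X]

lemma measurable_section (hφ : Measurable (Function.uncurry φ)) (b : EuclideanSpace ℝ (Fin k)) :
    Measurable fun x => φ x b :=
  hφ.comp (measurable_id.prodMk measurable_const)

lemma measurable_log_ratio (hφ : Measurable (Function.uncurry φ)) (θ : Param k) :
    Measurable fun x => Real.log (ratio φ x θ) := by
  simp_rw [log_ratio]
  exact (measurable_section hφ _).const_add _

/-- Each partial derivative is a pointwise limit of difference quotients, which are measurable in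
`x`. -/
lemma measurable_gradLogRatio (hφ : Measurable (Function.uncurry φ))
    (hd : ∀ x, DifferentiableAt ℝ (φ x) (betaPart θs)) :
    Measurable fun x => gradLogRatio φ x θs := by
  have hi : ∀ i, Measurable fun x => gradLogRatio φ x θs i := fun i => by
    have heq : ∀ x, gradLogRatio φ x θs i
        = fderiv ℝ (fun t => Real.log (ratio φ x t)) θs (EuclideanSpace.single i 1) := fun x => by
      rw [← inner_gradient_left, EuclideanSpace.inner_single_right]
      simp [gradLogRatio]
    refine measurable_of_tendsto_metrizable (f := fun (n : ℕ) x => (n : ℝ) •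
      (Real.log (ratio φ x (θs + (n : ℝ)⁻¹ • EuclideanSpace.single i 1))
        - Real.log (ratio φ x θs))) (fun n => ?_) (tendsto_pi_nhds.2 fun x => ?_)
    · exact ((measurable_log_ratio hφ _).sub (measurable_log_ratio hφ _)).const_mul _
    · rw [heq]
      refine (hasFDerivAt_log_ratio (hd x)).differentiableAt.hasFDerivAt.lim _ ?_
      simpa using tendsto_natCast_atTop_atTop
  have h2 : Measurable fun x => (fun i => gradLogRatio φ x θs i) := measurable_pi_lambda _ hi
  exact (WithLp.measurable_toLp 2 (Fin (k + 1) → ℝ)).comp h2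

variable {P : Measure X}

lemma matU_eq_smul_matM (hone : ∀ x, ratio φ x θs = 1) (ρ : ℝ) :
    matU P φ ρ θs = (1 + ρ)⁻¹ • matM P φ θs := by
  ext i j
  simp [matU, matM, hone, integral_const_mul]

lemma matM_zero_left (hd : ∀ x, DifferentiableAt ℝ (φ x) (betaPart θs)) (i : Fin (k + 1)) :
    matM P φ θs 0 i = ∫ x, gradLogRatio φ x θs i ∂P := by
  simp [matM, gradLogRatio_zero (hd _)]

lemma matM_comm (i j : Fin (k + 1)) : matM P φ θs i j = matM P φ θs j i := by
  simp [matM, mul_comm]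

lemma memLp_apply {g : X → Param k} (hg : MemLp g 2 P) (i : Fin (k + 1)) :
    MemLp (fun x => g x i) 2 P :=
  (EuclideanSpace.proj (𝕜 := ℝ) i).comp_memLp' hg

lemma covMat_gradLogRatio [IsProbabilityMeasure P]
    (hd : ∀ x, DifferentiableAt ℝ (φ x) (betaPart θs))
    (hL2 : MemLp (fun x => gradLogRatio φ x θs) 2 P) (i j : Fin (k + 1)) :
    covMat P (fun x => gradLogRatio φ x θs) i j
      = matM P φ θs i j - matM P φ θs 0 i * matM P φ θs 0 j := by
  rw [matM_zero_left hd, matM_zero_left hd]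
  simp only [covMat, matM, Matrix.of_apply]
  exact covariance_eq_sub (memLp_apply hL2 i) (memLp_apply hL2 j)

lemma covMat_gradient (hd : ∀ x, DifferentiableAt ℝ (φ x) (betaPart θs)) (i j : Fin k) :
    covMat P (fun x => gradient (φ x) (betaPart θs)) i j
      = covMat P (fun x => gradLogRatio φ x θs) i.succ j.succ := by
  simp [covMat, gradLogRatio_succ (hd _)]

end Model

/-! ### The non-central chi-square law. -/

section NoncentralChiSq

variable {k : ℕ}

lemma measurable_sum_sq : Measurable fun y : Fin k → ℝ => ∑ i, y i ^ 2 :=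
  Finset.measurable_fun_sum _ fun i _ => (measurable_pi_apply i).pow_const 2

/-- With all coordinates but the first fixed, `∑ y_i² = c` has at most two solutions in the first
one, a null set for a nondegenerate Gaussian; Fubini concludes. -/
lemma noncentralChiSq_singleton (hk : 1 ≤ k) (nc c : ℝ) : noncentralChiSq k nc {c} = 0 := by
  obtain ⟨k, rfl⟩ : ∃ j, k = j + 1 := ⟨k - 1, by omega⟩
  rw [noncentralChiSq, Measure.map_apply measurable_sum_sq (measurableSet_singleton c)]
  set μ : Fin (k + 1) → Measure ℝ :=
    fun i => gaussianReal (if i.val = 0 then Real.sqrt nc else 0) 1 with hμ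
  have : ∀ i, IsProbabilityMeasure (μ i) := fun i => by rw [hμ]; infer_instance
  have hmp := (measurePreserving_piFinSuccAbove μ 0)
  set e := MeasurableEquiv.piFinSuccAbove (fun _ : Fin (k + 1) => ℝ) 0
  have hs : MeasurableSet ((fun y : Fin (k + 1) → ℝ => ∑ i, y i ^ 2) ⁻¹' {c}) :=
    measurable_sum_sq (measurableSet_singleton c)
  rw [← hmp.symm.measure_preimage hs.nullMeasurableSet, Measure.prod_apply_symm (e.symm.measurable hs)]
  refine (lintegral_congr fun y => ?_).trans lintegral_zero
  have hna : NullSingletonClass (μ 0) := nullSingletonClass_gaussianReal one_ne_zero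
  refine Set.Finite.measure_zero (Set.Finite.subset
    (Set.toFinite {√(c - ∑ i, y i ^ 2), -√(c - ∑ i, y i ^ 2)}) fun x hx => ?_) _
  have hx : ∑ i, (e.symm (x, y)) i ^ 2 = c := hx
  rw [Fin.sum_univ_succ] at hx
  have h0 : e.symm (x, y) 0 = x := rfl
  have h1 : ∀ i : Fin k, e.symm (x, y) i.succ = y i := fun i => rfl
  simp only [h0, h1] at hx
  have h2 : x ^ 2 = c - ∑ i, y i ^ 2 := by linarith
  rw [← h2, Real.sqrt_sq_eq_abs]
  rcases abs_choice x with h | h <;> rw [h] <;> simp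

/-- The squared norm of a shifted standard Gaussian vector is noncentral chi-square. -/
lemma map_stdGaussian_norm_sq (hk : 1 ≤ k) (v : EuclideanSpace ℝ (Fin k)) :
    (stdGaussian (EuclideanSpace ℝ (Fin k))).map (fun ξ => ‖ξ + v‖ ^ 2)
      = noncentralChiSq k (‖v‖ ^ 2) := by
  obtain ⟨k, rfl⟩ : ∃ j, k = j + 1 := ⟨k - 1, by omega⟩
  -- A reflection takes `v` to the vector of the same length on the first axis, and the standard
  -- Gaussian law is invariant under it.
  set w : EuclideanSpace ℝ (Fin (k + 1)) := EuclideanSpace.single 0 ‖v‖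
  have hw : ‖v‖ = ‖w‖ := by simp [w]
  set O := Submodule.reflection (Submodule.span ℝ {v - w})ᗮ
  have hO : O v = w := Submodule.reflection_sub hw
  have h1 : (fun ξ : EuclideanSpace ℝ (Fin (k + 1)) => ‖ξ + v‖ ^ 2)
      = (fun ξ => ‖ξ + w‖ ^ 2) ∘ O := by
    funext ξ
    simp only [Function.comp]
    rw [← hO, ← map_add, O.norm_map]
  have hm : Measurable fun ξ : EuclideanSpace ℝ (Fin (k + 1)) => ‖ξ + w‖ ^ 2 := by fun_prop
  rw [h1, ← Measure.map_map hm O.continuous.measurable, stdGaussian_map, ← map_pi_eq_stdGaussian,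
    Measure.map_map hm (by fun_prop), noncentralChiSq]
  have h2 : (fun i : Fin (k + 1) => gaussianReal (if i.val = 0 then √(‖v‖ ^ 2) else 0) 1)
      = fun i => (gaussianReal 0 1).map (· + w i) := by
    funext i
    rw [gaussianReal_map_add_const, zero_add, Real.sqrt_sq (norm_nonneg v)]
    congr 1
    rcases eq_or_ne i 0 with rfl | hi
    · simp [w]
    · simp [w, hi]
  have hpm : ∀ i, IsProbabilityMeasure ((gaussianReal 0 1).map (· + w i)) := fun i =>
    Measure.isProbabilityMeasure_map (by fun_prop)
  rw [h2, ← Measure.pi_map_pi (fun i => by fun_prop),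
    Measure.map_map measurable_sum_sq (measurable_pi_lambda _ fun i => by fun_prop)]
  congr 1
  funext y
  simp [EuclideanSpace.real_norm_sq_eq]

end NoncentralChiSq

/-! ### The Gaussian limit of the quadratic forms. -/

section QuadraticLimit

open Matrix
open scoped MatrixOrder

variable {k : ℕ} {M V : Matrix (Fin (k + 1)) (Fin (k + 1)) ℝ}

/-- On vectors orthogonal to row `0` of `M`, the matrices `V` and `M` act alike; this is how the
singular `V` gets inverted below. -/
lemma mulVec_of_sub_rankOne (hV : ∀ i j, V i j = M i j - M 0 i * M 0 j) (u : Fin (k + 1) → ℝ) :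
    V *ᵥ u = M *ᵥ u - (∑ j, M 0 j * u j) • fun i => M 0 i := by
  ext i
  simp only [mulVec, dotProduct, hV, Pi.sub_apply, Pi.smul_apply, smul_eq_mul, sub_mul,
    Finset.sum_sub_distrib]
  congr 1
  rw [Finset.sum_mul]
  exact Finset.sum_congr rfl fun j _ => by ring

lemma quadratic_eq_dotProduct {d : ℕ} (A : Matrix (Fin d) (Fin d) ℝ) (z : Fin d → ℝ) :
    ∑ i, ∑ j, z i * A i j * z j = z ⬝ᵥ A *ᵥ z := by
  simp only [dotProduct, mulVec, Finset.mul_sum, mul_assoc]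

/-- The quadratic form of a matrix splits off its first row. -/
lemma quadratic_eq_add (h00 : M 0 0 = 1) (hsym : ∀ i j, M i j = M j i)
    (hV : ∀ i j, V i j = M i j - M 0 i * M 0 j) (z : Fin (k + 1) → ℝ) :
    ∑ i, ∑ j, z i * M i j * z j = (∑ j, M 0 j * z j) ^ 2
      + ∑ i : Fin k, ∑ j : Fin k, z i.succ * V i.succ j.succ * z j.succ := by
  have h1 : ∑ i : Fin k, ∑ j : Fin k, z i.succ * V i.succ j.succ * z j.succ
      = ∑ i, ∑ j, z i * V i j * z j := by
    -- The constant coordinate of the score has no covariance with anything, so row and column `0`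
    -- of `V` vanish and only the `β` block contributes.
    have h0 : ∀ i, V i 0 = 0 := fun i => by rw [hV, h00, hsym i 0]; ring
    have h0' : ∀ i, V 0 i = 0 := fun i => by rw [hV, h00]; ring
    simp [Fin.sum_univ_succ, h0, h0']
  rw [h1, quadratic_eq_dotProduct, quadratic_eq_dotProduct, mulVec_of_sub_rankOne hV,
    dotProduct_sub, dotProduct_smul]
  have : (z ⬝ᵥ fun i => M 0 i) = ∑ j, M 0 j * z j := by simp [dotProduct, mul_comm]
  rw [this, smul_eq_mul]
  ring

/-- The quadratic form at `x` is the variance of the linear combination `∑ x_i Y_i`. -/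
lemma posSemidef_covMat {X : Type*} [MeasurableSpace X] {P : Measure X} [IsProbabilityMeasure P]
    {d : ℕ} {Y : X → EuclideanSpace ℝ (Fin d)} (hY : MemLp Y 2 P) : (covMat P Y).PosSemidef := by
  refine PosSemidef.of_dotProduct_mulVec_nonneg ?_ fun x => ?_
  · ext i j
    simp [covMat, covariance_comm]
  · have hi : ∀ i, MemLp (fun ω => Y ω i) 2 P := fun i =>
      (EuclideanSpace.proj (𝕜 := ℝ) i).comp_memLp' hY
    have h1 := covariance_fun_sum_fun_sum (X := fun i ω => x i * Y ω i)
      (Y := fun i ω => x i * Y ω i) (μ := P)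
      (fun i => (hi i).const_mul _) (fun i => (hi i).const_mul _)
    rw [covariance_self (by
      refine Finset.aemeasurable_fun_sum _ fun i _ => ?_
      exact ((hi i).const_mul _).aestronglyMeasurable.aemeasurable)] at h1
    have h2 : star x ⬝ᵥ covMat P Y *ᵥ x = Var[fun ω => ∑ i, x i * Y ω i; P] := by
      rw [h1, star_trivial, ← quadratic_eq_dotProduct]
      refine Finset.sum_congr rfl fun i _ => Finset.sum_congr rfl fun j _ => ?_
      rw [covariance_const_mul_left, covariance_const_mul_right, covMat, of_apply]
      ring
    rw [h2]
    exact variance_nonneg _ _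

/-- The part of a positive semidefinite Gaussian vector that enters the quadratic form is standard
Gaussian after whitening. -/
lemma map_multivariateGaussian_whiten (hsym : ∀ i j, M i j = M j i) (h00 : M 0 0 = 1)
    (hdet : M.det ≠ 0) (hV : ∀ i j, V i j = M i j - M 0 i * M 0 j) (hpsd : V.PosSemidef)
    {c : ℝ} (hc : 0 < c) {R : Matrix (Fin k) (Fin k) ℝ}
    (hR : ∀ i j : Fin k, (Rᵀ * R) i j = V i.succ j.succ) :
    (multivariateGaussian (0 : Param k) ((c ^ 2)⁻¹ • V)).map
      (fun g => WithLp.toLp 2 (R *ᵥ fun i => ((c • M⁻¹) *ᵥ g.ofLp) i.succ))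
      = stdGaussian (EuclideanSpace ℝ (Fin k)) := by
  have hMT : M⁻¹ᵀ = M⁻¹ := by
    rw [transpose_nonsing_inv]
    congr 1
    ext i j
    exact hsym j i
  have hunit : IsUnit M.det := isUnit_iff_ne_zero.2 hdet
  have hV0 : ∀ j, V 0 j = 0 := fun j => by rw [hV, h00]; ring
  have hV0' : ∀ i, V i 0 = 0 := fun i => by rw [hV, h00, hsym i 0]; ring
  have htail : ∀ (u : Fin (k + 1) → ℝ), (fun i : Fin k => (V *ᵥ u) i.succ)
      = (Rᵀ * R) *ᵥ fun i => u i.succ := fun u => by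
    ext i
    simp [mulVec, dotProduct, Fin.sum_univ_succ (n := k), hV0', hR]
  -- A kernel vector `w` of the `β` block extends, by a first entry making it orthogonal to row `0`
  -- of `M`, to a nonzero `u` with `M u = V u = 0`, contradicting `hdet`.
  have hRdet : Rᵀ.det ≠ 0 := by
    have h1 : (Rᵀ * R).det ≠ 0 := by
      intro hcon
      obtain ⟨w, hw, hw0⟩ := Matrix.exists_mulVec_eq_zero_iff.2 hcon
      set u : Fin (k + 1) → ℝ := Fin.cons (-∑ j : Fin k, M 0 j.succ * w j) w with hu
      have hu0 : ∑ j, M 0 j * u j = 0 := by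
        rw [Fin.sum_univ_succ, h00]
        simp [hu]
      have hMu : M *ᵥ u = 0 := by
        have h2 := mulVec_of_sub_rankOne hV u
        rw [hu0, zero_smul, sub_zero] at h2
        rw [← h2]
        ext i
        refine Fin.cases ?_ (fun i => ?_) i
        · simp [mulVec, dotProduct, hV0]
        · have h3 := congrFun (htail u) i
          have h4 : (fun i : Fin k => u i.succ) = w := by ext; simp [hu]
          rw [h4, hw0] at h3
          exact h3
      refine hdet (Matrix.exists_mulVec_eq_zero_iff.1 ⟨u, fun h0 => hw ?_, hMu⟩)
      ext i
      have := congrFun h0 i.succ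
      simpa [hu] using this
    intro h0
    exact h1 (by rw [det_mul, h0, zero_mul])
  have hmeas : Measurable fun g : Param k =>
      (WithLp.toLp 2 (R *ᵥ fun i => ((c • M⁻¹) *ᵥ g.ofLp) i.succ) : EuclideanSpace ℝ (Fin k)) := by
    refine Continuous.measurable ?_
    refine (PiLp.continuous_toLp 2 _).comp (Continuous.matrix_mulVec continuous_const ?_)
    refine continuous_pi fun i => (continuous_apply i.succ).comp
      (Continuous.matrix_mulVec continuous_const (PiLp.continuous_ofLp 2 _))
  have hprob : IsProbabilityMeasure ((multivariateGaussian (0 : Param k) ((c ^ 2)⁻¹ • V)).map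
      (fun g => (WithLp.toLp 2 (R *ᵥ fun i => ((c • M⁻¹) *ᵥ g.ofLp) i.succ) :
        EuclideanSpace ℝ (Fin k)))) := Measure.isProbabilityMeasure_map hmeas.aemeasurable
  refine Measure.ext_of_charFun ?_
  funext t
  -- Characteristic functions: testing the image against `t` means testing `g` against `c u` with `u
  -- = M⁻¹ y`. As `y 0 = 0`, `u` is orthogonal to row `0` of `M`, so `V u = M u = y`; cancelling
  -- `Rᵀ` gives `R u_β = t`, and the variance is `u · y = ‖t‖²`.
  set y : Fin (k + 1) → ℝ := Fin.cons 0 (Rᵀ *ᵥ t.ofLp) with hy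
  set u : Fin (k + 1) → ℝ := M⁻¹ *ᵥ y with hu
  have hMu : M *ᵥ u = y := by
    rw [hu, mulVec_mulVec, mul_nonsing_inv _ hunit, one_mulVec]
  have hVu : V *ᵥ u = y := by
    have h2 := mulVec_of_sub_rankOne hV u
    have h3 : ∑ j, M 0 j * u j = 0 := by
      have := congrFun hMu 0
      simpa [mulVec, dotProduct, hy] using this
    rw [h2, h3, zero_smul, sub_zero, hMu]
  have hRu : (R *ᵥ fun i : Fin k => u i.succ) = t.ofLp := by
    have h2 := htail u
    rw [hVu] at h2
    have h3 : Rᵀ *ᵥ (R *ᵥ (fun i : Fin k => u i.succ)) = Rᵀ *ᵥ t.ofLp := by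
      rw [mulVec_mulVec, ← h2]
      ext i
      simp [hy]
    exact Matrix.mulVec_injective_of_isUnit ((isUnit_iff_isUnit_det _).2
      (isUnit_iff_ne_zero.2 hRdet)) h3
  have hyw : ∀ w : Fin (k + 1) → ℝ, t.ofLp ⬝ᵥ (R *ᵥ fun i : Fin k => w i.succ) = y ⬝ᵥ w := by
    intro w
    rw [dotProduct_mulVec, ← mulVec_transpose]
    simp [dotProduct, Fin.sum_univ_succ (n := k), hy]
  have hinner : ∀ g : Param k, inner ℝ (WithLp.toLp 2 (R *ᵥ fun i : Fin k =>
      ((c • M⁻¹) *ᵥ g.ofLp) i.succ) : EuclideanSpace ℝ (Fin k)) t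
      = inner ℝ g (WithLp.toLp 2 (c • u) : Param k) := fun g => by
    rw [EuclideanSpace.inner_eq_star_dotProduct, EuclideanSpace.inner_eq_star_dotProduct,
      star_trivial, star_trivial, hyw, smul_mulVec, dotProduct_smul, dotProduct_mulVec,
      ← mulVec_transpose, hMT, ← hu, smul_dotProduct]
  rw [charFun_apply, integral_map hmeas.aemeasurable (by fun_prop)]
  simp_rw [hinner]
  have hS : ((c ^ 2)⁻¹ • V).PosSemidef := hpsd.smul (by positivity)
  have hcf := charFun_multivariateGaussian (μ := (0 : Param k)) hS (WithLp.toLp 2 (c • u))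
  rw [charFun_apply] at hcf
  rw [hcf, charFun_stdGaussian]
  congr 1
  have hq : (WithLp.toLp 2 (c • u) : Param k).ofLp ⬝ᵥ ((c ^ 2)⁻¹ • V) *ᵥ
      (WithLp.toLp 2 (c • u) : Param k).ofLp = ‖t‖ ^ 2 := by
    rw [smul_mulVec, mulVec_smul, hVu, dotProduct_smul, smul_dotProduct, dotProduct_smul,
      dotProduct_comm, ← hyw, hRu, EuclideanSpace.real_norm_sq_eq]
    simp only [smul_eq_mul, dotProduct]
    field_simp
  rw [hq]
  simp [neg_div]

/-- The quadratic statistic of the limit of the local estimator is noncentral chi-square. -/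
lemma map_multivariateGaussian_quadratic (hk : 1 ≤ k) (hsym : ∀ i j, M i j = M j i)
    (h00 : M 0 0 = 1) (hdet : M.det ≠ 0) (hV : ∀ i j, V i j = M i j - M 0 i * M 0 j)
    (hpsd : V.PosSemidef) {c : ℝ} (hc : 0 < c) {h : Param k} (hh : ∑ j, M 0 j * h j = 0) :
    (multivariateGaussian (0 : Param k) ((c ^ 2)⁻¹ • V)).map
      (fun g => ∑ i : Fin k, ∑ j : Fin k, (h + toEuclideanLin (c • M⁻¹) g) i.succ
        * V i.succ j.succ * (h + toEuclideanLin (c • M⁻¹) g) j.succ)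
      = noncentralChiSq k (h ⬝ᵥ M *ᵥ h) := by
  set S : Matrix (Fin k) (Fin k) ℝ := V.submatrix Fin.succ Fin.succ with hS
  have hSpsd : S.PosSemidef := hpsd.submatrix _
  -- The symmetric square root turns the `β` quadratic form into the squared norm of `R z`.
  set R := CFC.sqrt S
  have hRT : Rᵀ = R := (CFC.sqrt_nonneg S).isSelfAdjoint
  have hRR : Rᵀ * R = S := by rw [hRT]; exact CFC.sqrt_mul_sqrt_self S hSpsd.nonneg
  have hquad : ∀ z : Fin k → ℝ, ∑ i : Fin k, ∑ j : Fin k, z i * V i.succ j.succ * z j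
      = ‖(WithLp.toLp 2 (R *ᵥ z) : EuclideanSpace ℝ (Fin k))‖ ^ 2 := fun z => by
    have h1 := quadratic_eq_dotProduct S z
    simp only [hS, submatrix_apply] at h1
    rw [h1, ← hS, ← hRR, ← mulVec_mulVec, dotProduct_mulVec, vecMul_transpose,
      EuclideanSpace.real_norm_sq_eq]
    simp [dotProduct, sq]
  set v : EuclideanSpace ℝ (Fin k) := WithLp.toLp 2 (R *ᵥ fun i => h i.succ) with hv
  -- The square split off by `quadratic_eq_add` vanishes at `h` by `hh`, so the full form and the
  -- `β` form give the same non-centrality.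
  have hvn : h ⬝ᵥ M *ᵥ h = ‖v‖ ^ 2 := by
    rw [hv, ← hquad (fun i => h i.succ), ← quadratic_eq_dotProduct, quadratic_eq_add h00 hsym hV, hh]
    simp
  have hwhite := map_multivariateGaussian_whiten hsym h00 hdet hV hpsd hc (R := R)
    (fun i j => by rw [hRR]; rfl)
  rw [hvn, ← map_stdGaussian_norm_sq hk v, ← hwhite, Measure.map_map]
  · congr 1
    funext g
    simp only [Function.comp]
    have hadd : (fun i : Fin k => (h + toEuclideanLin (c • M⁻¹) g) i.succ)
        = (fun i : Fin k => ((c • M⁻¹) *ᵥ g.ofLp) i.succ) + fun i : Fin k => h i.succ := by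
      ext i
      simp [toLpLin_apply, smul_mulVec, add_comm]
    rw [hquad fun i => (h + toEuclideanLin (c • M⁻¹) g) i.succ, hadd, mulVec_add, hv,
      WithLp.toLp_add]
  · fun_prop
  · refine Continuous.measurable ?_
    refine (PiLp.continuous_toLp 2 _).comp (Continuous.matrix_mulVec continuous_const ?_)
    refine continuous_pi fun i => (continuous_apply i.succ).comp
      (Continuous.matrix_mulVec continuous_const (PiLp.continuous_ofLp 2 _))

/-- In the limit, the first component of the local estimator is degenerate. -/
lemma ae_multivariateGaussian_row_eq_zero (h00 : M 0 0 = 1) (hdet : M.det ≠ 0)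
    (hV : ∀ i j, V i j = M i j - M 0 i * M 0 j) (hpsd : V.PosSemidef) {c : ℝ}
    {h : Param k} (hh : ∑ j, M 0 j * h j = 0) :
    ∀ᵐ g ∂(multivariateGaussian (0 : Param k) ((c ^ 2)⁻¹ • V)),
      ∑ j, M 0 j * (h + toEuclideanLin (c • M⁻¹) g) j = 0 := by
  have hS : ((c ^ 2)⁻¹ • V).PosSemidef := hpsd.smul (by positivity)
  have hmp := measurePreserving_eval_multivariateGaussian (μ := (0 : Param k)) hS (i := 0)
  -- Coordinate `0` is a Gaussian of variance zero, hence almost surely equal to its mean `0`.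
  have h0 : ((c ^ 2)⁻¹ • V) 0 0 = 0 := by simp [hV, h00]
  rw [h0, Real.toNNReal_zero, gaussianReal_zero_var] at hmp
  have hae : ∀ᵐ g ∂(multivariateGaussian (0 : Param k) ((c ^ 2)⁻¹ • V)), g 0 = 0 := by
    refine hmp.quasiMeasurePreserving.ae (p := fun x => x = 0) ?_
    rw [ae_dirac_eq]
    simp
  filter_upwards [hae] with g hg
  have hM : M *ᵥ (M⁻¹ *ᵥ g.ofLp) = g.ofLp := by
    rw [mulVec_mulVec, mul_nonsing_inv _ (isUnit_iff_ne_zero.2 hdet), one_mulVec]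
  have h1 : ∑ j, M 0 j * (M⁻¹ *ᵥ g.ofLp) j = 0 := (congrFun hM 0).trans hg
  calc _ = ∑ j, M 0 j * h j + c * ∑ j, M 0 j * (M⁻¹ *ᵥ g.ofLp) j := by
        rw [Finset.mul_sum, ← Finset.sum_add_distrib]
        refine Finset.sum_congr rfl fun j _ => ?_
        simp [toLpLin_apply]
        ring
    _ = 0 := by rw [hh, h1]; simp

end QuadraticLimit

/-! ### Comparison of the sample sizes with `m`. -/

section SampleSizes

lemma effSize_nonneg (mn md : ℕ) : 0 ≤ effSize mn md := by
  unfold effSize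
  positivity

lemma effSize_comm (mn md : ℕ) : effSize mn md = effSize md mn := by
  unfold effSize
  ring

lemma effSize_le (mn md : ℕ) : effSize mn md ≤ mn := by
  unfold effSize
  rw [mul_div_assoc]
  exact mul_le_of_le_one_right (Nat.cast_nonneg _) (div_le_one_of_le₀ (by simp) (by positivity))

lemma eventually_le_mul_effSize {mn md : ℕ → ℕ} (hmn : Tendsto mn atTop atTop)
    (hmd : Tendsto md atTop atTop) {ρ : ℝ}
    (hρlim : Tendsto (fun N => (mn N : ℝ) / md N) atTop (𝓝 ρ)) :
    ∃ C : ℝ, ∀ᶠ N in atTop, (mn N : ℝ) ≤ C * effSize (mn N) (md N) := by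
  -- Eventually `mn ≤ (ρ + 1) md`, so `mn + md ≤ (ρ + 2) md`.
  refine ⟨ρ + 2, ?_⟩
  filter_upwards [hmn.eventually_gt_atTop 0, hmd.eventually_gt_atTop 0,
    hρlim.eventually (gt_mem_nhds (lt_add_one ρ))] with N h1 h2 h3
  have h1' : (0 : ℝ) < mn N := by exact_mod_cast h1
  have h2' : (0 : ℝ) < md N := by exact_mod_cast h2
  rw [div_lt_iff₀ h2'] at h3
  unfold effSize
  rw [← mul_div_assoc, le_div_iff₀ (by positivity)]
  nlinarith

lemma tendsto_effSize {mn md : ℕ → ℕ} (hmn : Tendsto mn atTop atTop)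
    (hmd : Tendsto md atTop atTop) {ρ : ℝ} (hρ : 0 < ρ)
    (hρlim : Tendsto (fun N => (mn N : ℝ) / md N) atTop (𝓝 ρ)) :
    Tendsto (fun N => effSize (mn N) (md N)) atTop atTop := by
  have h : ∀ᶠ N in atTop, (mn N : ℝ) / (ρ + 2) ≤ effSize (mn N) (md N) := by
    filter_upwards [hmn.eventually_gt_atTop 0, hmd.eventually_gt_atTop 0,
      hρlim.eventually (gt_mem_nhds (lt_add_one ρ))] with N h1 h2 h3
    have h1' : (0 : ℝ) < mn N := by exact_mod_cast h1
    have h2' : (0 : ℝ) < md N := by exact_mod_cast h2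
    rw [div_lt_iff₀ h2'] at h3
    unfold effSize
    rw [div_le_div_iff₀ (by positivity) (by positivity)]
    nlinarith
  exact tendsto_atTop_mono' _ h
    ((tendsto_natCast_atTop_atTop.comp hmn).atTop_div_const (by positivity))

end SampleSizes

/-! ### Second-order expansion of `f` at its minimum. -/

section Expansion

open Asymptotics

/-- Second-order expansion at a critical zero. -/
lemma isLittleO_sub_quadratic {f : ℝ → ℝ} (hf0 : f 1 = 0) (hf1 : HasDerivAt f 0 1)
    (hfd : ∀ᶠ r in 𝓝 (1 : ℝ), DifferentiableAt ℝ f r) (hf2 : DifferentiableAt ℝ (deriv f) 1) :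
    (fun r => f r - deriv (deriv f) 1 / 2 * (r - 1) ^ 2) =o[𝓝 1] fun r => (r - 1) ^ 2 := by
  rw [isLittleO_iff]
  intro ε hε
  have h1 := isLittleO_iff.1 hf2.hasDerivAt.isLittleO hε
  obtain ⟨δ, hδ, hball⟩ := Metric.eventually_nhds_iff_ball.1 (h1.and hfd)
  filter_upwards [Metric.ball_mem_nhds (1 : ℝ) hδ] with r hr
  -- Differentiability of `f'` only at `1` bounds the derivative of the remainder by `ε |r − 1|` on
  -- this ball; the mean value inequality then yields `ε (r − 1)²`.
  set B := Metric.closedBall (1 : ℝ) |r - 1|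
  have hB : ∀ x ∈ B, x ∈ Metric.ball (1 : ℝ) δ := fun x hx => by
    rw [Metric.mem_ball, Real.dist_eq] at hr ⊢
    have : |x - 1| ≤ |r - 1| := by simpa [B, Real.dist_eq] using hx
    linarith
  have hd : ∀ x ∈ B, HasDerivAt (fun r => f r - deriv (deriv f) 1 / 2 * (r - 1) ^ 2)
      (deriv f x - deriv (deriv f) 1 * (x - 1)) x := fun x hx => by
    have h2 := (hball x (hB x hx)).2.hasDerivAt
    have h3 := ((((hasDerivAt_id x).sub_const 1).pow 2).const_mul (deriv (deriv f) 1 / 2))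
    refine (h2.sub h3).congr_deriv ?_
    simp
    ring
  have hbound : ∀ x ∈ B, ‖deriv f x - deriv (deriv f) 1 * (x - 1)‖ ≤ ε * |r - 1| := fun x hx => by
    have h2 := (hball x (hB x hx)).1
    rw [hf1.deriv, sub_zero, smul_eq_mul, mul_comm (x - 1)] at h2
    refine h2.trans ?_
    have : |x - 1| ≤ |r - 1| := by simpa [B, Real.dist_eq] using hx
    rw [Real.norm_eq_abs]
    gcongr
  have h2 := (convex_closedBall (1 : ℝ) |r - 1|).norm_image_sub_le_of_norm_hasDerivWithin_le
    (fun x hx => (hd x hx).hasDerivWithinAt) hbound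
    (Metric.mem_closedBall_self (abs_nonneg _)) (show r ∈ B by simp [B, Real.dist_eq])
  simp only [hf0, sub_self, ne_eq, OfNat.ofNat_ne_zero, not_false_eq_true, zero_pow, mul_zero,
    sub_zero] at h2
  refine h2.trans_eq ?_
  rw [Real.norm_eq_abs, Real.norm_eq_abs, abs_pow]
  ring

/-- Passing from `r - 1` to `s = log r` changes the square only by `o(s²)`, since `exp s − 1 − s =
o(s)`. -/
lemma isLittleO_comp_exp_sub_quadratic {f : ℝ → ℝ} (hf0 : f 1 = 0) (hf1 : HasDerivAt f 0 1)
    (hfd : ∀ᶠ r in 𝓝 (1 : ℝ), DifferentiableAt ℝ f r) (hf2 : DifferentiableAt ℝ (deriv f) 1) :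
    (fun s => f (Real.exp s) - deriv (deriv f) 1 / 2 * s ^ 2) =o[𝓝 0] fun s : ℝ => s ^ 2 := by
  have hexp : Tendsto Real.exp (𝓝 0) (𝓝 1) := by
    simpa using (Real.continuous_exp.tendsto 0)
  have h1 : (fun s => Real.exp s - 1 - s) =o[𝓝 0] fun s : ℝ => s := by
    have := (Real.hasDerivAt_exp 0).isLittleO
    simpa using this
  have hO : (fun s => Real.exp s - 1) =O[𝓝 0] fun s : ℝ => s := by
    have := h1.isBigO.add (isBigO_refl (fun s : ℝ => s) (𝓝 0))
    simpa using this
  have h2 := ((isLittleO_sub_quadratic hf0 hf1 hfd hf2).comp_tendsto hexp).trans_isBigO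
    (hO.pow 2 : (fun s => (Real.exp s - 1) ^ 2) =O[𝓝 0] fun s : ℝ => s ^ 2)
  have h3 : (fun s => (Real.exp s - 1) ^ 2 - s ^ 2) =o[𝓝 0] fun s : ℝ => s ^ 2 := by
    have h4 := h1.mul_isBigO (hO.add (isBigO_refl (fun s : ℝ => s) (𝓝 0)))
    refine h4.congr (fun s => ?_) (fun s => ?_) <;> ring
  refine (h2.add (h3.const_mul_left (deriv (deriv f) 1 / 2))).congr_left fun s => ?_
  simp only [Function.comp]
  ring

/-- The weights `u a s` may vary with the sample index, because the value used for `ρ` does; joint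
convergence as `s → 0` makes the expansion uniform in `s`. -/
lemma quadratic_expansion_mul {α : Type*} {l : Filter α} {u : α → ℝ → ℝ} {u₀ c : ℝ} {F : ℝ → ℝ}
    (hu : Tendsto (fun p : α × ℝ => u p.1 p.2) (l ×ˢ 𝓝 0) (𝓝 u₀))
    (hF : (fun s => F s - c * s ^ 2) =o[𝓝 0] fun s : ℝ => s ^ 2) (ε : ℝ) (hε : 0 < ε) :
    ∃ δ > 0, ∀ᶠ a in l, ∀ s, |s| ≤ δ → |u a s * F s - u₀ * c * s ^ 2| ≤ ε * s ^ 2 := by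
  have h1 : (fun p : α × ℝ => F p.2 - c * p.2 ^ 2) =o[l ×ˢ 𝓝 0] fun p => p.2 ^ 2 :=
    hF.comp_tendsto tendsto_snd
  have h2 : (fun p : α × ℝ => u p.1 p.2 * (F p.2 - c * p.2 ^ 2)) =o[l ×ˢ 𝓝 0] fun p => p.2 ^ 2 := by
    simpa using (hu.isBigO_one ℝ).mul_isLittleO h1
  have h3 : (fun p : α × ℝ => (u p.1 p.2 - u₀) * (c * p.2 ^ 2)) =o[l ×ˢ 𝓝 0] fun p => p.2 ^ 2 := by
    have h4 : (fun p : α × ℝ => u p.1 p.2 - u₀) =o[l ×ˢ 𝓝 0] fun _ => (1 : ℝ) :=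
      (isLittleO_one_iff ℝ).2 (tendsto_sub_nhds_zero_iff.2 hu)
    simpa using h4.mul_isBigO
      ((isBigO_refl (fun p : α × ℝ => p.2 ^ 2) (l ×ˢ 𝓝 0)).const_mul_left c)
  have h5 := isLittleO_iff.1 (h2.add h3) hε
  obtain ⟨pa, hpa, pb, hpb, hp⟩ := eventually_prod_iff.1 h5
  obtain ⟨δ, hδ, hball⟩ := Metric.eventually_nhds_iff_ball.1 hpb
  refine ⟨δ / 2, by positivity, hpa.mono fun a ha s hs => ?_⟩
  have h6 := hp ha (hball s (by rw [Metric.mem_ball, Real.dist_eq, sub_zero]; linarith))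
  rw [Real.norm_eq_abs, Real.norm_of_nonneg (sq_nonneg s)] at h6
  convert h6 using 2
  ring

end Expansion

/-! ### Uniform linearization over a sample. -/

section SampleConvergence

variable {X : Type*} [MeasurableSpace X] {Ω : ℕ → Type*} [∀ N, MeasurableSpace (Ω N)]
  {μ : ∀ N, Measure (Ω N)} {n : ℕ → ℕ} {Q : ℕ → Measure X} [∀ N, IsProbabilityMeasure (Q N)]
  {x : ∀ N, Ω N → Fin (n N) → X} {m : ℕ → ℝ}

/-- Union bound over the `n` observations: a set of probability `o(1/n)` is missed by the entire
sample. -/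
lemma eventually_forall_notMem
    (hx : ∀ N, MeasurePreserving (x N) (μ N) (Measure.pi fun _ : Fin (n N) => Q N))
    {A : ℕ → Set X} (hA : Tendsto (fun N => n N * (Q N (A N)).toReal) atTop (𝓝 0)) :
    ∀ᶠ a in whp μ, ∀ i, x a.1 a.2 i ∉ A a.1 := by
  refine eventually_whp_of_le (b := fun N => ENNReal.ofReal (n N * (Q N (A N)).toReal)) ?_
    (Eventually.of_forall fun N => ?_)
  · simpa using ENNReal.tendsto_ofReal hA
  · rw [ENNReal.ofReal_mul (Nat.cast_nonneg _), ENNReal.ofReal_natCast,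
      ENNReal.ofReal_toReal (measure_ne_top _ _)]
    refine le_trans ?_ (pi_exists_mem_le (Q N) (n N) (A N))
    refine le_trans (measure_mono fun ω hω => ?_)
      (measure_preimage_le_of_measurePreserving (hx N) {y | ∃ i, y i ∈ A N})
    simpa using hω

lemma tendsto_inv_mul_average
    (hx : ∀ N, MeasurePreserving (x N) (μ N) (Measure.pi fun _ : Fin (n N) => Q N))
    {K : X → ℝ} (hK : ∀ N, AEMeasurable K (Q N)) (hm : Tendsto m atTop atTop)
    (hbdd : ∃ C : NNReal, ∀ᶠ N in atTop, ∫⁻ x, ENNReal.ofReal (K x ^ 2) ∂(Q N) ≤ C) :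
    Tendsto (fun a : Σ N, Ω N => (m a.1)⁻¹ * ((n a.1 : ℝ)⁻¹ * ∑ i, |K (x a.1 a.2 i)| ^ 2))
      (whp μ) (𝓝 0) := by
  simp_rw [sq_abs]
  obtain ⟨C, hC⟩ := hbdd
  rw [tendsto_whp_zero_iff]
  intro ε hε
  have hlim : Tendsto (fun N => C / ENNReal.ofReal (ε * m N)) atTop (𝓝 0) := by
    have h1 : Tendsto (fun N => ENNReal.ofReal (ε * m N)) atTop (𝓝 ⊤) :=
      ENNReal.tendsto_ofReal_atTop.comp (hm.const_mul_atTop hε)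
    simpa using ENNReal.Tendsto.const_div h1 (Or.inr ENNReal.coe_ne_top)
  refine tendsto_of_tendsto_of_tendsto_of_le_of_le' tendsto_const_nhds hlim
    (Eventually.of_forall fun _ => zero_le) ?_
  filter_upwards [hC, hm.eventually_gt_atTop 0] with N h1 h2
  calc _ ≤ μ N ((x N) ⁻¹' {y | ε * m N ≤ (n N : ℝ)⁻¹ * ∑ i, K (y i) ^ 2}) := by
        refine measure_mono fun ω hω => ?_
        simp only [Set.mem_ofPred_eq, Set.mem_preimage] at hω ⊢
        rw [abs_of_nonneg (by positivity), inv_mul_eq_div, lt_div_iff₀ h2] at hω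
        exact hω.le
    _ ≤ _ := measure_preimage_le_of_measurePreserving (hx N) _
    _ ≤ _ := pi_average_ge_le (Q N) (n N) ((hK N).pow_const 2) (fun _ => sq_nonneg _)
        (by positivity)
    _ ≤ _ := by gcongr

/-- Averages over a sample of functions of the estimated log density ratio are asymptotically
quadratic in the local estimation error, on events where this error is bounded. -/
lemma tendsto_sample_average {d : ℕ}
    (hx : ∀ N, MeasurePreserving (x N) (μ N) (Measure.pi fun _ : Fin (n N) => Q N))
    (hm : ∀ N, 0 ≤ m N) (hmtop : Tendsto m atTop atTop)
    (hn : ∃ C : ℝ, ∀ᶠ N in atTop, (n N : ℝ) ≤ C * m N)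
    {g : X → EuclideanSpace ℝ (Fin d)} {K : X → ℝ} (hK : ∀ N, AEMeasurable K (Q N))
    (hbdd : ∃ C : NNReal, ∀ᶠ N in atTop, ∫⁻ x, ENNReal.ofReal (K x ^ 2) ∂(Q N) ≤ C)
    (hg : ∀ ε > 0, Tendsto (fun N => n N * (Q N {x | ε * m N < ‖g x‖ ^ 2}).toReal) atTop (𝓝 0))
    {M : Matrix (Fin d) (Fin d) ℝ}
    (hM : ∀ j k, Tendsto (fun a : Σ N, Ω N =>
      (n a.1 : ℝ)⁻¹ * ∑ i, g (x a.1 a.2 i) j * g (x a.1 a.2 i) k) (whp μ) (𝓝 (M j k)))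
    {L : X → EuclideanSpace ℝ (Fin d) → ℝ} {θs : EuclideanSpace ℝ (Fin d)}
    (hL : ∀ᶠ t in 𝓝 θs, ∀ x, |L x t - inner ℝ (g x) (t - θs)| ≤ |K x| * ‖t - θs‖ ^ 2)
    {l : Filter (Σ N, Ω N)} (hl : l ≤ whp μ) {θhat : (Σ N, Ω N) → EuclideanSpace ℝ (Fin d)}
    {R : ℝ} (hR : ∀ᶠ a in l, ‖√(m a.1) • (θhat a - θs)‖ ≤ R)
    {H : (Σ N, Ω N) → ℝ → ℝ} {c : ℝ}
    (hH : ∀ ε > 0, ∃ δ > 0, ∀ᶠ a in l, ∀ s, |s| ≤ δ → |H a s - c * s ^ 2| ≤ ε * s ^ 2) :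
    Tendsto (fun a => m a.1 * ((n a.1 : ℝ)⁻¹ * ∑ i, H a (L (x a.1 a.2 i) (θhat a)))
      - c * ∑ i, ∑ j, (√(m a.1) • (θhat a - θs)) i * M i j * (√(m a.1) • (θhat a - θs)) j)
      l (𝓝 0) := by
  have hmtop' : Tendsto (fun a : Σ N, Ω N => m a.1) l atTop := hmtop.comp (tendsto_fst_whp.mono_left hl)
  have hδ : ∀ a : Σ N, Ω N, 0 < m a.1 →
      θhat a - θs = (√(m a.1))⁻¹ • (√(m a.1) • (θhat a - θs)) := fun a ha => by
    rw [smul_smul, inv_mul_cancel₀ (Real.sqrt_pos.2 ha).ne', one_smul]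
  have hconv : Tendsto θhat l (𝓝 θs) := by
    rw [← tendsto_sub_nhds_zero_iff]
    have h1 : Tendsto (fun a : Σ N, Ω N => (√(m a.1))⁻¹ * R) l (𝓝 0) := by
      simpa using ((tendsto_inv_atTop_zero.comp (Real.tendsto_sqrt_atTop.comp hmtop')).mul_const R)
    refine squeeze_zero_norm' ?_ h1
    filter_upwards [hR, hmtop'.eventually_gt_atTop 0] with a h2 h3
    rw [hδ a h3, norm_smul, norm_inv, Real.norm_of_nonneg (Real.sqrt_nonneg _)]
    gcongr
  refine tendsto_average_local (n := fun a : Σ N, Ω N => n a.1) (m := fun a => m a.1)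
    (g := fun a i => g (x a.1 a.2 i)) (κ := fun a i => |K (x a.1 a.2 i)|)
    (δ := fun a => θhat a - θs) (fun a => hm _) hmtop' hH hR (fun ε hε => ?_)
    (fun j k => (hM j k).mono_left hl) (fun ε hε => ?_) ?_ hδ ?_
  · refine hl ((eventually_forall_notMem hx (hg ε hε)).mono fun a ha i => ?_)
    simpa using ha i
  · refine hl ((eventually_forall_notMem hx
      (tendsto_size_mul_measure_remainder hK hmtop hn hbdd hε)).mono fun a ha i => ?_)
    simpa using ha i
  · exact (tendsto_inv_mul_average hx hK hmtop hbdd).mono_left hl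
  · exact (hconv.eventually hL).mono fun a ha i => ha _

end SampleConvergence

/-! ### From the normalized error to the local estimation error. -/

section LocalError

open Matrix

variable {d : ℕ} {α : Type*} {l : Filter α}

lemma tendsto_matrix_inv {β : Type*} {l : Filter β} {A : β → Matrix (Fin d) (Fin d) ℝ}
    {A₀ : Matrix (Fin d) (Fin d) ℝ} (hA : Tendsto A l (𝓝 A₀)) (h0 : A₀.det ≠ 0) :
    Tendsto (fun b => (A b)⁻¹) l (𝓝 A₀⁻¹) := by
  simp_rw [Matrix.inv_def, Ring.inverse_eq_inv']
  have h1 : Tendsto (fun b => (A b).det) l (𝓝 A₀.det) :=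
    (continuous_id.matrix_det.tendsto A₀).comp hA
  have h2 : Tendsto (fun b => (A b).adjugate) l (𝓝 A₀.adjugate) :=
    (continuous_id.matrix_adjugate.tendsto A₀).comp hA
  exact (h1.inv₀ h0).smul h2

lemma tendsto_toEuclideanLin_sub {A : α → Matrix (Fin d) (Fin d) ℝ}
    {A₀ : Matrix (Fin d) (Fin d) ℝ} (hA : Tendsto A l (𝓝 A₀)) {G : α → EuclideanSpace ℝ (Fin d)}
    {R : ℝ} (hG : ∀ᶠ a in l, ‖G a‖ ≤ R) :
    Tendsto (fun a => toEuclideanLin (A a) (G a) - toEuclideanLin A₀ (G a)) l (𝓝 0) := by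
  have hi : ∀ i, Tendsto (fun a => ∑ j, G a j * (A a i j - A₀ i j)) l (𝓝 0) := fun i => by
    have : ∀ j, Tendsto (fun a => G a j * (A a i j - A₀ i j)) l (𝓝 0) := fun j => by
      refine bdd_le_mul_tendsto_zero' R ?_ (tendsto_sub_nhds_zero_iff.2 ?_)
      · exact hG.mono fun a ha => (PiLp.norm_apply_le (G a) j).trans ha
      · exact (tendsto_pi_nhds.1 (tendsto_pi_nhds.1 hA i)) j
    simpa using tendsto_finsetSum Finset.univ fun j _ => this j
  have h := ((PiLp.continuous_toLp 2 (fun _ : Fin d => ℝ)).tendsto 0).comp (tendsto_pi_nhds.2 hi)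
  refine h.congr fun a => ?_
  ext i
  simp only [Function.comp, toLpLin_apply, mulVec, dotProduct, PiLp.sub_apply,
    ← Finset.sum_sub_distrib]
  exact Finset.sum_congr rfl fun j _ => by ring

/-- The local estimation error is an affine function of the normalized error, up to a term that
vanishes where the latter is bounded. -/
lemma tendsto_local_error {U : α → Matrix (Fin d) (Fin d) ℝ} {U₀ : Matrix (Fin d) (Fin d) ℝ}
    (hU : Tendsto U l (𝓝 U₀)) (h0 : U₀.det ≠ 0) {r : α → ℝ} (hr : ∀ᶠ a in l, 0 < r a)
    {h : α → EuclideanSpace ℝ (Fin d)} {hlim : EuclideanSpace ℝ (Fin d)}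
    (hh : Tendsto h l (𝓝 hlim)) {θhat θ : α → EuclideanSpace ℝ (Fin d)}
    {θs : EuclideanSpace ℝ (Fin d)} (hθ : ∀ a, θ a = θs + (r a)⁻¹ • h a)
    {R : ℝ} (hG : ∀ᶠ a in l, ‖r a • toEuclideanLin (U a) (θhat a - θ a)‖ ≤ R) :
    Tendsto (fun a => r a • (θhat a - θs)
      - (hlim + toEuclideanLin U₀⁻¹ (r a • toEuclideanLin (U a) (θhat a - θ a)))) l (𝓝 0) := by
  have h1 := tendsto_toEuclideanLin_sub (tendsto_matrix_inv hU h0) hG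
  have h2 := h1.add (tendsto_sub_nhds_zero_iff.2 hh)
  rw [add_zero] at h2
  have hdet : ∀ᶠ a in l, (U a).det ≠ 0 :=
    ((continuous_id.matrix_det.tendsto U₀).comp hU).eventually_ne h0
  refine h2.congr' ?_
  filter_upwards [hr, hdet] with a ha1 ha2
  have h3 : toEuclideanLin (U a)⁻¹ (r a • toEuclideanLin (U a) (θhat a - θ a))
      = r a • (θhat a - θ a) := by
    rw [map_smul]
    congr 1
    ext i
    simp only [toLpLin_apply]
    rw [mulVec_mulVec, nonsing_inv_mul _ (isUnit_iff_ne_zero.2 ha2), one_mulVec]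
  have h4 : r a • (θhat a - θs) = r a • (θhat a - θ a) + h a := by
    rw [hθ a, ← sub_sub, smul_sub _ (θhat a - θs), smul_inv_smul₀ ha1.ne', sub_add_cancel]
  rw [h3, h4]
  abel

/-- Quadratic forms are uniformly continuous on bounded sets: each difference of products splits
into two terms that are linear in `y - z`. -/
lemma tendsto_quadratic_sub_quadratic (A : Matrix (Fin d) (Fin d) ℝ)
    {y z : α → EuclideanSpace ℝ (Fin d)} (hyz : Tendsto (fun a => y a - z a) l (𝓝 0))
    {R : ℝ} (hy : ∀ᶠ a in l, ‖y a‖ ≤ R) (hz : ∀ᶠ a in l, ‖z a‖ ≤ R) :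
    Tendsto (fun a => ∑ i, ∑ j, y a i * A i j * y a j - ∑ i, ∑ j, z a i * A i j * z a j)
      l (𝓝 0) := by
  have hc : ∀ i, Tendsto (fun a => y a i - z a i) l (𝓝 0) := fun i => by
    have := ((EuclideanSpace.proj (𝕜 := ℝ) i).continuous.tendsto 0).comp hyz
    rw [map_zero] at this
    exact this
  have h : ∀ i j, Tendsto (fun a => (A i j * y a j) * (y a i - z a i)
      + (A i j * z a i) * (y a j - z a j)) l (𝓝 0) := fun i j => by
    have h1 : Tendsto (fun a => (A i j * y a j) * (y a i - z a i)) l (𝓝 0) := by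
      refine bdd_le_mul_tendsto_zero' (|A i j| * R) ?_ (hc i)
      filter_upwards [hy] with a ha
      rw [abs_mul]
      gcongr
      exact (PiLp.norm_apply_le (y a) j).trans ha
    have h2 : Tendsto (fun a => (A i j * z a i) * (y a j - z a j)) l (𝓝 0) := by
      refine bdd_le_mul_tendsto_zero' (|A i j| * R) ?_ (hc j)
      filter_upwards [hz] with a ha
      rw [abs_mul]
      gcongr
      exact (PiLp.norm_apply_le (z a) i).trans ha
    simpa using h1.add h2
  have h2 : Tendsto (fun a => ∑ i, ∑ j, ((A i j * y a j) * (y a i - z a i)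
      + (A i j * z a i) * (y a j - z a j))) l (𝓝 0) := by
    simpa using tendsto_finsetSum Finset.univ fun i _ => tendsto_finsetSum Finset.univ
      fun j _ => h i j
  refine h2.congr fun a => ?_
  rw [← Finset.sum_sub_distrib]
  refine Finset.sum_congr rfl fun i _ => ?_
  rw [← Finset.sum_sub_distrib]
  exact Finset.sum_congr rfl fun j _ => by ring

end LocalError

/-! ### A crude bound for the largest score under the alternatives. -/

section LargeScore

variable {X : Type*} [MeasurableSpace X] {Ω : ℕ → Type*} [∀ N, MeasurableSpace (Ω N)]
  {μ : ∀ N, Measure (Ω N)} {n : ℕ → ℕ} {Q : ℕ → Measure X} [∀ N, IsProbabilityMeasure (Q N)]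
  {x : ∀ N, Ω N → Fin (n N) → X} {m : ℕ → ℝ}

/-- Where the empirical second moments converge, no observation contributes more than a bounded
multiple of the sample size. -/
lemma exists_large_score {d : ℕ}
    (hx : ∀ N, MeasurePreserving (x N) (μ N) (Measure.pi fun _ : Fin (n N) => Q N))
    (hm : ∀ N, 0 ≤ m N) (hn : ∃ C : ℝ, ∀ᶠ N in atTop, (n N : ℝ) ≤ C * m N)
    {g : X → EuclideanSpace ℝ (Fin d)} (hg : Measurable g) {M : Matrix (Fin d) (Fin d) ℝ}
    (hM : ∀ j k, Tendsto (fun a : Σ N, Ω N =>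
      (n a.1 : ℝ)⁻¹ * ∑ i, g (x a.1 a.2 i) j * g (x a.1 a.2 i) k) (whp μ) (𝓝 (M j k))) :
    ∃ L > (0 : ℝ),
      Tendsto (fun N => n N * (Q N {x | L * m N < ‖g x‖ ^ 2}).toReal) atTop (𝓝 0) := by
  obtain ⟨C, hC⟩ := hn
  set T := ∑ j, M j j
  have hT : Tendsto (fun a : Σ N, Ω N => (n a.1 : ℝ)⁻¹ * ∑ i, ‖g (x a.1 a.2 i)‖ ^ 2)
      (whp μ) (𝓝 T) := by
    refine (tendsto_finsetSum Finset.univ fun j _ => hM j j).congr fun a => ?_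
    rw [← Finset.mul_sum, Finset.sum_comm]
    simp_rw [EuclideanSpace.real_norm_sq_eq, sq]
  have hA : ∀ N, MeasurableSet {x | (|C| + 1) * (|T| + 1) * m N < ‖g x‖ ^ 2} := fun N =>
    measurableSet_lt measurable_const (hg.norm.pow_const 2)
  -- One squared norm is at most their sum, eventually below `(T + 1) n ≤ (T + 1) C m`; absolute
  -- values make the constants positive.
  refine ⟨(|C| + 1) * (|T| + 1), by positivity, tendsto_mul_measure_of_exists_mem hA ?_⟩
  have hev : ∀ᶠ a in whp μ, ¬ ∃ i, x a.1 a.2 i ∈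
      {x | (|C| + 1) * (|T| + 1) * m a.1 < ‖g x‖ ^ 2} := by
    filter_upwards [hT.eventually (gt_mem_nhds (lt_add_one T)), tendsto_fst_whp.eventually hC]
      with a h1 h2
    rintro ⟨i, hi⟩
    refine absurd hi (not_lt.2 ?_)
    have hn0 : (0 : ℝ) < n a.1 := by exact_mod_cast i.pos
    rw [inv_mul_eq_div, div_lt_iff₀ hn0] at h1
    have h3 : ‖g (x a.1 a.2 i)‖ ^ 2 ≤ ∑ i, ‖g (x a.1 a.2 i)‖ ^ 2 :=
      Finset.single_le_sum (f := fun i => ‖g (x a.1 a.2 i)‖ ^ 2) (fun _ _ => sq_nonneg _)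
        (Finset.mem_univ i)
    calc _ ≤ (T + 1) * n a.1 := h3.trans h1.le
      _ ≤ (|T| + 1) * ((|C| + 1) * m a.1) := by
          have := hm a.1
          gcongr
          · exact le_abs_self T
          · refine h2.trans ?_
            gcongr
            exact (le_abs_self C).trans (by linarith)
      _ = _ := by ring
  refine (eventually_whp.1 hev).congr fun N => ?_
  rw [← (hx N).measure_preimage]
  · congr 1
    ext ω
    simp
  · have : {ω : Fin (n N) → X | ∃ i, ω i ∈ {x | (|C| + 1) * (|T| + 1) * m N < ‖g x‖ ^ 2}}
        = ⋃ i, Function.eval i ⁻¹' {x | (|C| + 1) * (|T| + 1) * m N < ‖g x‖ ^ 2} := by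
      ext; simp
    rw [this]
    exact (MeasurableSet.iUnion fun i => measurable_pi_apply i (hA N)).nullMeasurableSet

end LargeScore

end DensityRatio

end

/-! ### The asymptotic power of the two tests. -/

open DensityRatio in
theorem theorem3
    {X : Type*} [MeasurableSpace X] {k : ℕ} (hk : 1 ≤ k)
    -- the law with density `p`, the model, the parameter space and the null parameter
    (P : Measure X) [IsProbabilityMeasure P]
    (φ : X → EuclideanSpace ℝ (Fin k) → ℝ) (hφ : Measurable (Function.uncurry φ))
    (Θ : Set (Param k)) (hΘ : IsOpen Θ)
    (hdiff : ∀ x, ∀ t ∈ Θ, DifferentiableAt ℝ (φ x) (betaPart t))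
    (θs : Param k) (hθs : θs ∈ Θ) (hone : ∀ x, ratio φ x θs = 1)
    -- the function defining the divergence
    (f : ℝ → ℝ) (hf : ConvexOn ℝ (Set.Ioi 0) f) (hf0 : f 1 = 0) (hf1 : HasDerivAt f 0 1)
    (hfd : ∀ᶠ r in 𝓝 (1 : ℝ), DifferentiableAt ℝ f r)
    (hf2 : DifferentiableAt ℝ (deriv f) 1) (hf2pos : 0 < deriv (deriv f) 1)
    -- the sample sizes; `w N` is the value used for `ρ` in the estimators
    (mn md : ℕ → ℕ) (hmn : Tendsto mn atTop atTop) (hmd : Tendsto md atTop atTop)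
    (ρ : ℝ) (hρ : 0 < ρ) (hρlim : Tendsto (fun N => (mn N : ℝ) / md N) atTop (𝓝 ρ))
    (w : ℕ → ℝ) (hw : Tendsto w atTop (𝓝 ρ))
    -- the local alternatives
    (h : ℕ → Param k) (hlim : Param k) (hh : Tendsto h atTop (𝓝 hlim))
    (θ : ℕ → Param k)
    (hθ : ∀ N, θ N = θs + (Real.sqrt (effSize (mn N) (md N)))⁻¹ • h N)
    [∀ N, IsProbabilityMeasure (numLaw P φ (θ N))]
    -- `M` and `U` are finite, continuous and non-degenerate near the null parameter
    (hL2 : ∀ᶠ t in 𝓝 θs, MemLp (fun x => gradLogRatio φ x t) 2 P)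
    (hM : ∀ᶠ t in 𝓝 θs, ContinuousAt (matM P φ) t ∧ (matM P φ t).det ≠ 0)
    (hU : ∀ᶠ t in 𝓝 θs, ContinuousAt (matU P φ ρ) t ∧ (matU P φ ρ t).det ≠ 0)
    -- second-order control of `φ(x; ·)` at the null parameter (void if `φ` is linear in `β`)
    (K : X → ℝ) (hK : MemLp K 2 P)
    (hKn : ∃ C : NNReal, ∀ᶠ N in atTop,
      ∫⁻ x, ENNReal.ofReal (K x ^ 2) ∂(numLaw P φ (θ N)) ≤ C)
    (hKφ : ∀ᶠ b in 𝓝 (betaPart θs), ∀ x,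
      |φ x b - φ x (betaPart θs) - inner ℝ (gradient (φ x) (betaPart θs)) (b - betaPart θs)|
        ≤ K x * ‖b - betaPart θs‖ ^ 2)
    -- the law of large numbers under the local alternatives
    (hLLN : ∀ i j, ∀ ε > (0 : ℝ), Tendsto
      (fun N => sampleLaw (numLaw P φ (θ N)) P (mn N) (md N)
        {ω | ε < |(mn N : ℝ)⁻¹ * ∑ l, gradRatio φ (ω.1 l) θs i * gradRatio φ (ω.1 l) θs j
          - matM P φ θs i j|}) atTop (𝓝 0))
    -- the moment matching estimator
    (θhat : (N : ℕ) → (Fin (mn N) → X) × (Fin (md N) → X) → Param k)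
    (hθhat : ∀ N, Measurable (θhat N))
    (hest : Tendsto
      (fun N => sampleLaw (numLaw P φ (θ N)) P (mn N) (md N)
        {ω | θhat N ω ∈ Θ ∧ estimatingFn φ (w N) ω.1 ω.2 (θhat N ω) = 0}) atTop (𝓝 1))
    -- its central limit theorem under the local alternatives
    (hCLT : TendstoInDistribution
      (fun N ω => Real.sqrt (effSize (mn N) (md N)) •
        Matrix.toEuclideanLin (matU P φ ρ (θ N)) (θhat N ω - θ N))
      atTop (fun z : Param k => z)
      (fun N => sampleLaw (numLaw P φ (θ N)) P (mn N) (md N))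
      (multivariateGaussian 0
        (((1 + ρ) ^ 2)⁻¹ • covMat P (fun x => gradLogRatio φ x θs))))
    -- a consistent estimator of the variance of `∇_β φ`
    (Vhat : (N : ℕ) → (Fin (mn N) → X) × (Fin (md N) → X) → Matrix (Fin k) (Fin k) ℝ)
    (hVhat : ∀ i j, ∀ ε > (0 : ℝ), Tendsto
      (fun N => sampleLaw (numLaw P φ (θ N)) P (mn N) (md N)
        {ω | ε < |Vhat N ω i j - covMat P (fun x => gradient (φ x) (betaPart θs)) i j|})
      atTop (𝓝 0))
    -- the significance level
    (a : ℝ) (ha0 : 0 < a) (ha1 : a < 1) :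
    Tendsto
      (fun N => sampleLaw (numLaw P φ (θ N)) P (mn N) (md N)
        {ω | deriv (deriv f) 1 / (2 * effSize (mn N) (md N)) * chiSqQuantile k (1 - a)
          ≤ divergenceEst φ f (w N) ω.1 ω.2 (θhat N ω)})
      atTop
      (𝓝 (noncentralChiSq k (hlim ⬝ᵥ (matM P φ θs).mulVec hlim)
        (Set.Ici (chiSqQuantile k (1 - a))))) ∧
    Tendsto
      (fun N => sampleLaw (numLaw P φ (θ N)) P (mn N) (md N)
        {ω | chiSqQuantile k (1 - a)
          < scoreStat (effSize (mn N) (md N)) (Vhat N ω) (θhat N ω) θs})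
      atTop
      (𝓝 (noncentralChiSq k (hlim ⬝ᵥ (matM P φ θs).mulVec hlim)
        (Set.Ici (chiSqQuantile k (1 - a))))) := by
  have hd : ∀ x, DifferentiableAt ℝ (φ x) (betaPart θs) := fun x => hdiff x θs hθs
  set g : X → Param k := fun x => gradLogRatio φ x θs with hg_def
  set m : ℕ → ℝ := fun N => effSize (mn N) (md N) with hm_def
  set Q : ℕ → Measure X := fun N => numLaw P φ (θ N) with hQ_def
  set μ := fun N => sampleLaw (Q N) P (mn N) (md N) with hμ_def
  set M := matM P φ θs with hM_def
  set V := covMat P g with hV_def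
  have hQprob : ∀ N, IsProbabilityMeasure (Q N) := inferInstance
  have hm0 : ∀ N, 0 ≤ m N := fun N => effSize_nonneg _ _
  have hmtop : Tendsto m atTop atTop := tendsto_effSize hmn hmd hρ hρlim
  have hnC : ∃ C : ℝ, ∀ᶠ N in atTop, (mn N : ℝ) ≤ C * m N :=
    eventually_le_mul_effSize hmn hmd hρlim
  have hdC : ∃ C : ℝ, ∀ᶠ N in atTop, (md N : ℝ) ≤ C * m N := by
    have hinv : Tendsto (fun N => (md N : ℝ) / mn N) atTop (𝓝 ρ⁻¹) := by
      simpa using hρlim.inv₀ hρ.ne'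
    obtain ⟨C, hC⟩ := eventually_le_mul_effSize hmd hmn hinv
    exact ⟨C, hC.mono fun N hN => by rwa [effSize_comm] at hN⟩
  have hgL2 : MemLp g 2 P := hL2.self_of_nhds
  have hgm : Measurable g := measurable_gradLogRatio hφ hd
  have hsym : ∀ i j, M i j = M j i := fun i j => matM_comm i j
  have h00 : M 0 0 = 1 := by simp [hM_def, matM, gradLogRatio_zero (hd _)]
  have hdet : M.det ≠ 0 := hM.self_of_nhds.2
  have hVM : ∀ i j, V i j = M i j - M 0 i * M 0 j := covMat_gradLogRatio hd hgL2
  have hpsd : V.PosSemidef := posSemidef_covMat hgL2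
  have hc : 0 < 1 + ρ := by linarith
  have hxn : ∀ N, MeasurePreserving Prod.fst (μ N) (Measure.pi fun _ : Fin (mn N) => Q N) :=
    fun N => measurePreserving_num _ _ _ _
  have hxd : ∀ N, MeasurePreserving Prod.snd (μ N) (Measure.pi fun _ : Fin (md N) => P) :=
    fun N => measurePreserving_den _ _ _ _
  -- empirical second moments
  have hMn : ∀ i j, Tendsto (fun a : Σ N, (Fin (mn N) → X) × (Fin (md N) → X) =>
      (mn a.1 : ℝ)⁻¹ * ∑ l, g (a.2.1 l) i * g (a.2.1 l) j) (whp μ) (𝓝 (M i j)) := fun i j => by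
    rw [tendsto_whp_iff]
    intro ε hε
    have h1 := hLLN i j ε hε
    simp only [gradRatio_eq_gradLogRatio (hd _) (hone _)] at h1
    exact h1
  have hMd : ∀ i j, Tendsto (fun a : Σ N, (Fin (mn N) → X) × (Fin (md N) → X) =>
      (md a.1 : ℝ)⁻¹ * ∑ l, g (a.2.2 l) i * g (a.2.2 l) j) (whp μ) (𝓝 (M i j)) := fun i j => by
    rw [tendsto_whp_iff]
    intro ε hε
    have hgi : ∀ i, Measurable fun x => g x i := fun i =>
      (EuclideanSpace.proj (𝕜 := ℝ) i).continuous.measurable.comp hgm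
    have h1 := (pi_weak_law P (f := fun x => g x i * g x j) ((hgi i).mul (hgi j))
      ((memLp_apply hgL2 i).integrable_mul (memLp_apply hgL2 j)) hε).comp hmd
    refine tendsto_of_tendsto_of_tendsto_of_le_of_le tendsto_const_nhds h1 (fun _ => zero_le)
      fun N => ?_
    exact measure_preimage_le_of_measurePreserving (hxd N)
      {y | ε < |(md N : ℝ)⁻¹ * ∑ l, g (y l) i * g (y l) j - M i j|}
  -- the local alternatives
  have happrox := eventually_log_ratio_approx hd hone hKφ
  have hθlim : Tendsto θ atTop (𝓝 θs) := by
    have h1 : Tendsto (fun N => θs + (√(m N))⁻¹ • h N) atTop (𝓝 (θs + (0 : ℝ) • hlim)) :=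
      tendsto_const_nhds.add
        ((tendsto_inv_atTop_zero.comp (Real.tendsto_sqrt_atTop.comp hmtop)).smul hh)
    rw [zero_smul, add_zero] at h1
    exact h1.congr fun N => (hθ N).symm
  have hlocal : LocalDensity P g K (fun N x => Real.log (ratio φ x (θ N))) Q m mn h hlim :=
    { isProbabilityMeasure := hQprob
      measurable_score := hgm
      memLp_score := hgL2
      memLp_remainder := hK
      measurable_log := fun N => measurable_log_ratio hφ _
      eq_withDensity := fun N => by simp only [hQ_def, numLaw, ← ratio_eq_exp_log]
      tendsto_atTop := hmtop
      size_le := hnC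
      le_size := fun N => effSize_le _ _
      tendsto_param := hh
      approx := by
        filter_upwards [hθlim.eventually happrox] with N hN x
        have h1 := hN x
        rwa [show θ N - θs = (√(m N))⁻¹ • h N by rw [hθ N, add_sub_cancel_left]] at h1
      remainder_bdd := hKn
      large_score := exists_large_score hxn hm0 hnC hgm hMn }
  -- Row `0` of `M` is the mean of the score, which the local parameter annihilates.
  have hhM : ∑ j, M 0 j * hlim j = 0 := by
    rw [← hlocal.integral_inner_eq_zero]
    have h1 : ∀ x, inner ℝ (g x) hlim = ∑ j, g x j * hlim j := fun x => by
      rw [PiLp.inner_apply]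
      exact Finset.sum_congr rfl fun j _ => by simp [mul_comm]
    simp_rw [h1]
    rw [integral_finsetSum _ fun j _ => ((memLp_apply hgL2 j).integrable one_le_two).mul_const _]
    refine Finset.sum_congr rfl fun j _ => ?_
    rw [integral_mul_const, hM_def, matM_zero_left hd]
  -- the two quadratic forms and the limit of the local estimator
  set ν : Measure (Param k) := multivariateGaussian 0 (((1 + ρ) ^ 2)⁻¹ • V) with hν_def
  set z : Param k → Param k :=
    fun v => hlim + Matrix.toEuclideanLin ((1 + ρ) • M⁻¹) v with hz_def
  set qM : Param k → ℝ := fun v => ∑ i, ∑ j, v i * M i j * v j with hqM_def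
  set qV : Param k → ℝ :=
    fun v => ∑ i : Fin k, ∑ j : Fin k, v i.succ * V i.succ j.succ * v j.succ with hqV_def
  have hzc : Continuous z := continuous_const.add (LinearMap.continuous_of_finiteDimensional _)
  have hcoord : ∀ i, Continuous fun v : Param k => v i := fun i =>
    (EuclideanSpace.proj (𝕜 := ℝ) i).continuous
  have hqMc : Continuous qM := continuous_finsetSum _ fun i _ => continuous_finsetSum _ fun j _ =>
    ((hcoord i).mul continuous_const).mul (hcoord j)
  have hqVc : Continuous qV := continuous_finsetSum _ fun i _ => continuous_finsetSum _ fun j _ =>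
    ((hcoord i.succ).mul continuous_const).mul (hcoord j.succ)
  have hlaw : ν.map (qV ∘ z) = noncentralChiSq k (hlim ⬝ᵥ M.mulVec hlim) :=
    map_multivariateGaussian_quadratic hk hsym h00 hdet hVM hpsd hc hhM
  -- The forms differ by the square of `∑ j, M 0 j * z j`, which vanishes almost surely; hence the
  -- two tests have the same limiting power.
  have hqae : ∀ᵐ v ∂ν, qM (z v) = qV (z v) := by
    filter_upwards [ae_multivariateGaussian_row_eq_zero h00 hdet hVM hpsd hhM] with v hv
    have h1 := quadratic_eq_add h00 hsym hVM (z v)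
    rw [hv] at h1
    simpa using h1
  have hpre : ∀ A : Set ℝ, MeasurableSet A → ν {v | qV (z v) ∈ A}
      = noncentralChiSq k (hlim ⬝ᵥ M.mulVec hlim) A := fun A hA => by
    rw [← hlaw, Measure.map_apply (hqVc.comp hzc).measurable hA]
    rfl
  have hpre' : ∀ A : Set ℝ, MeasurableSet A → ν {v | qM (z v) ∈ A}
      = noncentralChiSq k (hlim ⬝ᵥ M.mulVec hlim) A := fun A hA => by
    rw [← hpre A hA]
    refine measure_congr ?_
    filter_upwards [hqae] with v hv
    change (qM (z v) ∈ A) = (qV (z v) ∈ A)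
    rw [hv]
  -- the normalized error and the events on which it is bounded
  set G : ∀ N, (Fin (mn N) → X) × (Fin (md N) → X) → Param k := fun N ω =>
    √(m N) • Matrix.toEuclideanLin (matU P φ ρ (θ N)) (θhat N ω - θ N) with hG_def
  have htight := tight_of_tendstoInDistribution hCLT
  set Z : (Σ N, (Fin (mn N) → X) × (Fin (md N) → X)) → Param k :=
    fun a => √(m a.1) • (θhat a.1 a.2 - θs) with hZ_def
  set FR : ℝ → Filter (Σ N, (Fin (mn N) → X) × (Fin (md N) → X)) :=
    fun R => whp μ ⊓ 𝓟 {a | ‖G a.1 a.2‖ ≤ R} with hFR_def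
  have hFRle : ∀ R, FR R ≤ whp μ := fun R => inf_le_left
  have hfst : ∀ R, Tendsto Sigma.fst (FR R) atTop := fun R => tendsto_fst_whp.mono_left (hFRle R)
  have hGR : ∀ R, ∀ᶠ a in FR R, ‖G a.1 a.2‖ ≤ R := fun R =>
    eventually_inf_principal.2 (Eventually.of_forall fun _ h => h)
  have hU0 : matU P φ ρ θs = (1 + ρ)⁻¹ • M := matU_eq_smul_matM hone ρ
  have hUinv : (matU P φ ρ θs)⁻¹ = (1 + ρ) • M⁻¹ := by
    refine Matrix.inv_eq_right_inv ?_
    rw [hU0, Matrix.smul_mul, Matrix.mul_smul, smul_smul, inv_mul_cancel₀ hc.ne', one_smul,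
      Matrix.mul_nonsing_inv _ (isUnit_iff_ne_zero.2 hdet)]
  have herr : ∀ R, Tendsto (fun a => Z a - z (G a.1 a.2)) (FR R) (𝓝 0) := fun R => by
    have h1 := tendsto_local_error (l := FR R) (U := fun a => matU P φ ρ (θ a.1))
      (r := fun a => √(m a.1)) (h := fun a => h a.1) (θhat := fun a => θhat a.1 a.2)
      (θ := fun a => θ a.1) (hU.self_of_nhds.1.tendsto.comp (hθlim.comp (hfst R)))
      hU.self_of_nhds.2
      (((Real.tendsto_sqrt_atTop.comp hmtop).comp (hfst R)).eventually_gt_atTop 0)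
      (hh.comp (hfst R)) (fun a => hθ a.1) (hGR R)
    rw [hUinv] at h1
    exact h1
  -- The affine map `z` is bounded where `G` is, and `Z` eventually differs from `z (G)` by less
  -- than `1`.
  have hbdd : ∀ R, ∃ B : ℝ, (∀ᶠ a in FR R, ‖Z a‖ ≤ B) ∧ ∀ᶠ a in FR R, ‖z (G a.1 a.2)‖ ≤ B := by
    intro R
    set A := LinearMap.toContinuousLinearMap (Matrix.toEuclideanLin ((1 + ρ) • M⁻¹))
    have h1 : ∀ᶠ a in FR R, ‖z (G a.1 a.2)‖ ≤ ‖hlim‖ + ‖A‖ * R := by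
      filter_upwards [hGR R] with a ha
      refine (norm_add_le _ _).trans (add_le_add le_rfl ?_)
      exact (A.le_opNorm _).trans (by gcongr)
    refine ⟨‖hlim‖ + ‖A‖ * R + 1, ?_, h1.mono fun a ha => by linarith⟩
    filter_upwards [h1, (herr R).norm.eventually (gt_mem_nhds (by simp : ‖(0 : Param k)‖ < 1))]
      with a h2 h3
    have := norm_le_norm_add_norm_sub' (Z a) (z (G a.1 a.2))
    linarith
  -- the divergence statistic
  set D2 := deriv (deriv f) 1 with hD2_def
  set TD : (Σ N, (Fin (mn N) → X) × (Fin (md N) → X)) → ℝ := fun a =>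
    2 / D2 * (m a.1 * divergenceEst φ f (w a.1) a.2.1 a.2.2 (θhat a.1 a.2)) with hTD_def
  have hTD : Tendsto (fun a => TD a - qM (z (G a.1 a.2))) (whp μ) (𝓝 0) := by
    refine tendsto_whp_of_tight htight fun R => ?_
    obtain ⟨B, hB1, hB2⟩ := hbdd R
    have hF := isLittleO_comp_exp_sub_quadratic hf0 hf1 hfd hf2
    have hw' : Tendsto (fun p : (Σ N, (Fin (mn N) → X) × (Fin (md N) → X)) × ℝ => w p.1.1)
        (FR R ×ˢ 𝓝 0) (𝓝 ρ) := (hw.comp (hfst R)).comp tendsto_fst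
    have hden : Tendsto (fun p : (Σ N, (Fin (mn N) → X) × (Fin (md N) → X)) × ℝ =>
        (1 + w p.1.1 * Real.exp p.2)⁻¹) (FR R ×ˢ 𝓝 0) (𝓝 (1 + ρ)⁻¹) := by
      have h1 : Tendsto (fun p : (Σ N, (Fin (mn N) → X) × (Fin (md N) → X)) × ℝ => Real.exp p.2)
          (FR R ×ˢ 𝓝 0) (𝓝 1) := by
        have := (Real.continuous_exp.tendsto 0).comp
          (tendsto_snd (f := FR R) (g := 𝓝 (0 : ℝ)))
        rwa [Real.exp_zero] at this
      have h2 := ((hw'.mul h1).const_add 1).inv₀ (by rw [mul_one]; exact hc.ne')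
      rwa [mul_one] at h2
    have hnum := hw'.mul hden
    have hKae : ∀ N, AEMeasurable K (Q N) := fun N =>
      hK.aestronglyMeasurable.aemeasurable.mono_ac (hlocal.absolutelyContinuous N)
    have hKP : ∃ C : NNReal, ∀ᶠ _N : ℕ in atTop, ∫⁻ x, ENNReal.ofReal (K x ^ 2) ∂P ≤ C := by
      have h1 : ∫⁻ x, ENNReal.ofReal (K x ^ 2) ∂P ≠ ⊤ := hK.integrable_sq.lintegral_lt_top.ne
      exact ⟨(∫⁻ x, ENNReal.ofReal (K x ^ 2) ∂P).toNNReal, Eventually.of_forall fun _ =>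
        (ENNReal.coe_toNNReal h1).ge⟩
    have hgP : ∀ ε > 0, Tendsto (fun N => md N * (P {x | ε * m N < ‖g x‖ ^ 2}).toReal)
        atTop (𝓝 0) := fun ε hε => by
      refine tendsto_size_mul_zero (fun _ => ENNReal.toReal_nonneg) hdC ?_
      have h2 := (tendsto_mul_measure_gt P (f := fun x => ‖g x‖ ^ 2) (hgm.norm.pow_const 2)
        (hgL2.integrable_norm_pow two_ne_zero) (hmtop.const_mul_atTop hε)).const_mul ε⁻¹
      rw [mul_zero] at h2
      refine h2.congr fun N => ?_
      field_simp
    have hn := tendsto_sample_average (θhat := fun a => θhat a.1 a.2) hxn hm0 hmtop hnC hKae hKn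
      (fun ε hε => hlocal.tendsto_score hε) hMn happrox (hFRle R) hB1
      (quadratic_expansion_mul (u := fun a s => w a.1 * (1 + w a.1 * Real.exp s)⁻¹) hnum hF)
    have hd' := tendsto_sample_average (θhat := fun a => θhat a.1 a.2) (Q := fun _ => P) hxd hm0
      hmtop hdC (fun _ => hK.aestronglyMeasurable.aemeasurable) hKP hgP hMd happrox (hFRle R) hB1
      (quadratic_expansion_mul (u := fun a s => (1 + w a.1 * Real.exp s)⁻¹) hden hF)
    have hq := tendsto_quadratic_sub_quadratic M (herr R) hB1 hB2
    -- The coefficients from the two samples are `(1 + ρ)⁻¹ D2 / 2` and `ρ (1 + ρ)⁻¹ D2 / 2`; they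
    -- sum to `D2 / 2`, which the factor `2 / D2` cancels, so `f` disappears.
    have hsum := ((hd'.add hn).const_mul (2 / D2)).add hq
    simp only [add_zero, mul_zero] at hsum
    refine hsum.congr fun a => ?_
    have e1 : ∀ x, f (ratio φ x (θhat a.1 a.2)) / (1 + w a.1 * ratio φ x (θhat a.1 a.2))
        = (1 + w a.1 * Real.exp (Real.log (ratio φ x (θhat a.1 a.2))))⁻¹
          * f (Real.exp (Real.log (ratio φ x (θhat a.1 a.2)))) := fun x => by
      rw [← ratio_eq_exp_log, div_eq_mul_inv, mul_comm]
    have e2 : ∀ x, w a.1 * f (ratio φ x (θhat a.1 a.2)) / (1 + w a.1 * ratio φ x (θhat a.1 a.2))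
        = w a.1 * (1 + w a.1 * Real.exp (Real.log (ratio φ x (θhat a.1 a.2))))⁻¹
          * f (Real.exp (Real.log (ratio φ x (θhat a.1 a.2)))) := fun x => by
      rw [mul_div_assoc, e1, mul_assoc]
    simp only [hTD_def, divergenceEst, e1, e2, hqM_def, hZ_def]
    have hD2 : D2 ≠ 0 := hf2pos.ne'
    field_simp
    ring
  -- the score statistic
  set TS : (Σ N, (Fin (mn N) → X) × (Fin (md N) → X)) → ℝ := fun a =>
    scoreStat (m a.1) (Vhat a.1 a.2) (θhat a.1 a.2) θs with hTS_def
  have hTS : Tendsto (fun a => TS a - qV (z (G a.1 a.2))) (whp μ) (𝓝 0) := by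
    refine tendsto_whp_of_tight htight fun R => ?_
    obtain ⟨B, hB1, hB2⟩ := hbdd R
    set S : Matrix (Fin k) (Fin k) ℝ := V.submatrix Fin.succ Fin.succ
    have hV' : ∀ i j, Tendsto (fun a : Σ N, (Fin (mn N) → X) × (Fin (md N) → X) =>
        Vhat a.1 a.2 i j) (FR R) (𝓝 (S i j)) := fun i j => by
      refine Tendsto.mono_left ?_ (hFRle R)
      rw [tendsto_whp_iff]
      intro ε hε
      have h1 := hVhat i j ε hε
      rw [covMat_gradient hd] at h1
      exact h1
    have hβ : ∀ v : Param k, ‖v‖ ≤ B → ‖betaPart v‖ ≤ B := fun v hv => (norm_betaPart_le v).trans hv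
    have h1 := tendsto_quadratic_sub (z := fun a => betaPart (Z a)) hV'
      (hB1.mono fun a ha => hβ _ ha)
    have hdiffβ : Tendsto (fun a => betaPart (Z a) - betaPart (z (G a.1 a.2))) (FR R) (𝓝 0) := by
      have h2 := ((betaCLM k).continuous.tendsto 0).comp (herr R)
      rw [map_zero] at h2
      exact h2.congr fun a => betaPart_sub _ _
    have h2 := tendsto_quadratic_sub_quadratic S hdiffβ (hB1.mono fun a ha => hβ _ ha)
      (hB2.mono fun a ha => hβ _ ha)
    have h3 := h1.add h2
    rw [add_zero] at h3
    refine h3.congr fun a => ?_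
    have e1 : TS a = ∑ i, ∑ j, betaPart (Z a) i * Vhat a.1 a.2 i j * betaPart (Z a) j := by
      simp only [hTS_def, scoreStat, hZ_def, Finset.mul_sum, ← betaPart_sub, betaPart_apply,
        PiLp.smul_apply, smul_eq_mul]
      refine Finset.sum_congr rfl fun i _ => Finset.sum_congr rfl fun j _ => ?_
      -- The factor `m` is split as `√m * √m`, one for each of the two arguments of the form.
      nth_rewrite 1 [← Real.mul_self_sqrt (hm0 a.1)]
      ring
    rw [e1, sub_add_sub_cancel]
    rfl
  -- conclusion
  set q := chiSqQuantile k (1 - a) with hq_def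
  have hatom := noncentralChiSq_singleton hk (hlim ⬝ᵥ M.mulVec hlim) q
  constructor
  · have h1 := tendsto_measure_tail hCLT (hqMc.comp hzc) hTD (c := q)
      (A := fun N => {ω | D2 / (2 * m N) * q ≤ divergenceEst φ f (w N) ω.1 ω.2 (θhat N ω)})
      ((hpre' {q} (measurableSet_singleton q)).trans hatom) ?_ ?_
    · exact (hpre' (Set.Ici q) measurableSet_Ici) ▸ h1
    all_goals
      filter_upwards [hmtop.eventually_gt_atTop 0] with N hN ω hω
      -- Multiplying by `2 m / D2 > 0` turns the threshold of the test into the quantile itself;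
      -- this needs `m > 0`.
      have hiff : D2 / (2 * m N) * q ≤ divergenceEst φ f (w N) ω.1 ω.2 (θhat N ω)
          ↔ q ≤ TD ⟨N, ω⟩ := by
        simp only [hTD_def]
        rw [div_mul_eq_mul_div, div_le_iff₀ (by positivity), div_mul_eq_mul_div,
          le_div_iff₀ hf2pos]
        constructor <;> intro h <;> linarith
    · exact hiff.2 (le_of_lt hω)
    · exact hiff.1 hω
  · have h1 := tendsto_measure_tail hCLT (hqVc.comp hzc) hTS (c := q)
      (A := fun N => {ω | q < scoreStat (m N) (Vhat N ω) (θhat N ω) θs})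
      ((hpre {q} (measurableSet_singleton q)).trans hatom)
      (Eventually.of_forall fun N ω hω => hω)
      (Eventually.of_forall fun N ω (hω : q < TS ⟨N, ω⟩) => hω.le)
    exact (hpre (Set.Ici q) measurableSet_Ici) ▸ h1
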